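/- Let $m\ge 2$ be an integer. Let $X_0^*$ be a random variable with values in $\{1,2,3,\dots\}$ and, for $p\in(0,1)$, let $X_0$ be a random variable with law $P_{X_0}=(1-p)\,\delta_0+p\,P_{X_0^*}$, where $\delta_0$ is the unit mass at $0$. Define recursively the laws of $X_n$, $n\ge 0$, by $X_{n+1}=(X_{n,1}+\cdots+X_{n,m}-1)^+$, where $X_{n,1},\dots,X_{n,m}$ are independent copies of $X_n$ and $a^+=\max\{a,0\}$. **Proposition.** Fix $\delta\in(0,\frac{1}{16m})$. Assume that $c_1:=\mathbb P(X_0^*\ge 2)>0$ and $c_2:=\mathbb E\big(m^{(1-\delta)X_0^*}\big)<\infty$. Then there exist constants $c_3,c_4,c_5>0$, depending only on $m,\delta,c_1,c_2$ (in particular not on $p$, $n$, $M$, nor otherwise on the law of $X_0^*$), such that for all $p\in(0,1)$ and all integers $n>M\ge 1$, $$\prod_{i=0}^{M-1}\Big(\mathbb E\big(m^{(1-\delta)(X_i\wedge (M-i))}\big)\Big)^{m-1}\le c_3\,m^{2\delta M}\qquad\text{or}\qquad \mathbb P(X_n=0)\le c_5\,e^{-c_4 m^{n-M}}.$$ -/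

import Mathlib

open MeasureTheory

noncomputable section

namespace DerridaRetaux

/-- The law `(1 - p) δ₀ + p ν` of the initial variable `X₀`, where `ν` is the law of `X₀*`. -/
def initialLaw (ν : Measure ℕ) (p : ℝ) : Measure ℕ :=
  ENNReal.ofReal (1 - p) • Measure.dirac 0 + ENNReal.ofReal p • ν

/-- One step of the recursion: the law of `(Y₁ + ⋯ + Yₘ - 1)⁺`, where `Y₁, …, Yₘ` are
independent with law `μ`. Truncated subtraction on `ℕ` is the positive part. -/
def step (m : ℕ) (μ : Measure ℕ) : Measure ℕ :=
  (Measure.pi fun _ : Fin m => μ).map fun y => (∑ i, y i) - 1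

/-- The law of `Xₙ` in the Derrida–Retaux system with `P_{X₀} = (1 - p) δ₀ + p ν`. -/
def law (m : ℕ) (ν : Measure ℕ) (p : ℝ) : ℕ → Measure ℕ
  | 0 => initialLaw ν p
  | n + 1 => step m (law m ν p n)

end DerridaRetaux

end

/-!
# A dichotomy for the Derrida–Retaux recursion

Write `μ i` for the law of `Xᵢ`, and test supercriticality at time `M` by the single number
`b * E (2 ^ (-X_M))`, where `b ^ (m - 1) = 2`. Since `(S - 1)⁺ ≥ S - 1`, this number is at most
raised to the power `m` by each step (`mul_halfMoment_le_pow`). If it is below `exp (-c₄)` at time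
`M`, then `P (X_n = 0) ≤ exp (-c₄ * m ^ (n - M))`, which is the second alternative.

Otherwise it exceeds `1 - c₄` at all times `i ≤ M`, and this has two consequences. A large value at
one vertex survives up to time `M`, so the tails obey `P (Xᵢ ≥ k) ≤ 3 * m ^ 2 * m ^ (-k)` as long as
`i + k ≤ M` (`measureReal_Ici_le`). And `P (Xᵢ = 0)` is bounded below uniformly
(`le_measureReal_zero`); for `m = 2` this rests on `P (X₀* ≥ 2) > 0`, without which `Xᵢ` could stay
concentrated near the constant `1`, which is a fixed point of the recursion.

Now fix `s < m` very close to `m`, put `Y = Xᵢ ∧ (M - i)`, and follow `G = E (s ^ Y)`,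
`A = E (Y s ^ Y)`, `B = E (Y ^ 2 s ^ Y)`. Truncation commutes with the recursion
(`min_sum_sub_one`), so that up to an error which the tail bounds make negligible
(`stepRel_moments`) a step gives, for the drift `H = (s - 1) A - G` and for `R = A + B`,

* `H' = G ^ (m - 1) * ((m / s) * (H + G) - G)`,
* `R' = (m / s) * G ^ (m - 1) * (B - A + (m - 1) * A ^ 2 / G)`, which is at least
  `(m / s) * G ^ (m - 1) * (R - G / (m - 1))`.

The factor `G ^ (m - 1)` is the one in the product to be estimated. Once `H > 0`, the inequality
`H' ≥ G ^ (m - 1) * H` bounds the rest of the product by a ratio of bounded quantities. While `H` is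
not markedly positive, the quantity `-H + η R` grows at least like the product, up to factors
`1 - θ`, except at steps where both `|H| / G` and `R / G` are moderate. At such nearly critical
steps the Cauchy–Schwarz inequality on the event `Y ≠ 0`, combined with the lower bound on
`P (Xᵢ = 0)`, forces `R / G` to increase by a fixed amount (`StepRel.spread_growth`). This growth is lost only
while `-H / G` is large, and from there `-H / G` descends by at most `m / s - 1` per step, so that a
return to the nearly critical range takes a long time. Hence the exceptional steps are rare, which
is encoded in the bounded quantity `budget`; the resulting Lyapunov function
(`Tuning.lyapunov_step`) shows that the product grows with an arbitrarily small exponential rate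
(`Tuning.prod_le`).
-/

/-! ### Weighted moments and the one-step relations -/

namespace DerridaRetaux

/-- The moments of a law on `ℕ`, weighted by `s ^ x`, that the recursion on weighted moments
involves. -/
structure WeightedMoments where
  /-- `E (s ^ Y)` -/
  G : ℝ
  /-- `E (Y * s ^ Y)` -/
  A : ℝ
  /-- `E (Y ^ 2 * s ^ Y)` -/
  B : ℝ
  /-- `P (Y = 0)` -/
  q : ℝ

namespace WeightedMoments

/-- The normalised gap `-H / G` of the drift `H = (s - 1) A - G`. It is close to `0` for nearly
critical laws, close to `1` for laws concentrated at `0`, and negative for supercritical laws. -/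
noncomputable def gap (s : ℝ) (w : WeightedMoments) : ℝ := 1 - (s - 1) * w.A / w.G

/-- The normalised second moment `R / G` with `R = E (Y (Y + 1) s ^ Y)`. -/
noncomputable def spread (w : WeightedMoments) : ℝ := (w.A + w.B) / w.G

/-- Relations between the weighted moments of a single law that puts mass at least `c` at `0`.
The inequality `sq_le` is Cauchy–Schwarz on the event `Y ≠ 0`, and `G_le` comes from the splitting
into `Y ≤ 8` and `Y ≥ 8`. -/
structure Admissible (m : ℕ) (c : ℝ) (w : WeightedMoments) : Prop where
  one_le : 1 ≤ w.G
  A_nonneg : 0 ≤ w.A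
  A_le_B : w.A ≤ w.B
  sq_le : w.A ^ 2 ≤ w.B * (w.G - w.q)
  le_q : c ≤ w.q
  q_le : w.q ≤ 1
  G_le : w.G ≤ (m : ℝ) ^ 8 + w.A / 8

/-- The relations between the moments `w` of a law and the moments `w'` after one step of the
recursion and truncation; `ε` bounds the effect of the truncation. -/
structure StepRel (m : ℕ) (s ε : ℝ) (w w' : WeightedMoments) : Prop where
  mass_le : w'.G ≤ w.G ^ m / s + (1 - 1 / s) * w.q ^ m
  drift_le : (s - 1) * w'.A - w'.G ≤ m / s * (s - 1) * w.A * w.G ^ (m - 1) - w.G ^ m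
  le_drift : m / s * (s - 1) * w.A * w.G ^ (m - 1) - w.G ^ m - ε ≤ (s - 1) * w'.A - w'.G
  le_second : m / s * w.G ^ (m - 1) * (w.B - w.A + (m - 1) * w.A ^ 2 / w.G) - ε ≤ w'.A + w'.B

end WeightedMoments

/-! ### Growth of the spread at nearly critical steps -/

lemma pow_gap_ineq {m : ℕ} (hm : 2 ≤ m) {x : ℝ} (hx : 0 ≤ x) :
    (1 - x) * (m + x * (1 - x)) ≤ (1 - x ^ m) * (m - (m - 1) * x) := by
  induction m, hm using Nat.le_induction with
  | base => push_cast; nlinarith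
  | succ k hk ih =>
    have h : 0 ≤ k * x ^ k * (1 - x) ^ 2 := by positivity
    push_cast
    have e1 : x ^ (k + 1) = x ^ k * x := pow_succ x k
    rw [e1]
    nlinarith

lemma one_sub_pow_le (m : ℕ) {x : ℝ} (hx : 0 ≤ x) :
    1 - x ^ m ≤ m * (1 - x) := by
  have h := one_add_mul_le_pow (a := x - 1) (by linarith) m
  have : (1 + (x - 1)) = x := by ring
  rw [this] at h
  linarith

/-- The quantitative form of the growth of the spread: `x` stands for `q / G`, and `g₁`, `g₂` for
`A / G`, `B / G`. At exact criticality `g₁ = 1 / (m - 1)`, and the left-hand side without its last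
two terms is the value for which the spread is stationary. -/
lemma spread_gain {m : ℕ} (hm : 2 ≤ m) {x x₀ y₁ K g₁ g₂ : ℝ} (hx₀ : 0 < x₀) (hx : x₀ ≤ x)
    (hx1 : x ≤ 1) (hy₁ : 0 ≤ y₁) (hy₁' : y₁ ≤ 1 / 2) (hg₁ : (1 - y₁) / (m - 1) ≤ g₁)
    (hcs : g₁ ^ 2 ≤ g₂ * (1 - x)) (hK : g₁ + g₂ ≤ K) :
    (m : ℝ) / (m - 1) + x₀ / (4 * K * (m - 1) ^ 3) - 6 * y₁ ≤
      (m - 1) * (1 - x ^ m) * (g₁ + g₂) := by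
  have hm' : (2 : ℝ) ≤ m := by exact_mod_cast hm
  set n : ℝ := (m : ℝ) - 1 with hn
  have hn1 : 1 ≤ n := by linarith
  have hmn : (m : ℝ) = n + 1 := by rw [hn]; ring
  have hn0 : 0 < n := by linarith
  have hxpos : 0 < x := by linarith
  have hg₁half : 1 / (2 * n) ≤ g₁ := by
    refine le_trans ?_ hg₁
    rw [div_le_div_iff₀ (by positivity) hn0]; nlinarith
  have hg₁pos : 0 < g₁ := lt_of_lt_of_le (by positivity) hg₁half
  have hprod : 0 < g₂ * (1 - x) := lt_of_lt_of_le (by positivity) hcs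
  have hw : 0 < 1 - x := by
    rcases (sub_nonneg.mpr hx1).eq_or_lt with h | h
    · rw [← h] at hprod; simp at hprod
    · exact h
  have hg₂pos : 0 < g₂ := pos_of_mul_pos_left hprod hw.le
  have hKpos : 0 < K := by linarith
  set w : ℝ := 1 - x with hwdef
  have hg₂ : g₁ ^ 2 / w ≤ g₂ := by rw [div_le_iff₀ hw]; exact hcs
  have hwK : 1 / (4 * K * n ^ 2) ≤ w := by
    rw [div_le_iff₀ (by positivity)]
    have h1 : (1 / (2 * n)) ^ 2 ≤ g₁ ^ 2 := by gcongr
    have h2 : g₁ ^ 2 ≤ K * w := hcs.trans (by gcongr; linarith)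
    have h3 := h1.trans h2
    rw [div_pow, div_le_iff₀ (by positivity)] at h3
    nlinarith
  -- the extremal configuration, in which Cauchy-Schwarz is an equality
  have hZ0 : (1 - y₁) ^ 2 * (1 / n + (1 / n) ^ 2 / w) ≤ g₁ + g₂ := by
    have h1 : (1 - y₁) ^ 2 * (1 / n) ≤ g₁ := by
      refine le_trans ?_ hg₁
      rw [mul_one_div]
      gcongr
      nlinarith
    have h2 : (1 - y₁) ^ 2 * ((1 / n) ^ 2 / w) ≤ g₂ := by
      refine le_trans ?_ hg₂
      rw [← mul_div_assoc]
      gcongr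
      rw [← mul_pow, mul_one_div]
      gcongr
      exact div_nonneg (by linarith) hn0.le
    linarith [mul_add ((1 - y₁) ^ 2) (1 / n) ((1 / n) ^ 2 / w)]
  have hpow1 : x ^ m ≤ 1 := pow_le_one₀ hxpos.le hx1
  have hfac : 0 ≤ n * (1 - x ^ m) := mul_nonneg hn0.le (by linarith)
  set Z : ℝ := (1 - x ^ m) * (1 + 1 / n / w) with hZ
  -- `Z` is `(m - 1) * (1 - x ^ m)` times the extremal value of `g₁ + g₂`
  have hZle : Z ≤ 3 := by
    have h1 := one_sub_pow_le m hxpos.le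
    have h2 : Z = (1 - x ^ m) + (1 - x ^ m) / (n * w) := by
      rw [hZ]; field_simp
    have h3 : (1 - x ^ m) / (n * w) ≤ 2 := by
      rw [div_le_iff₀ (by positivity)]
      refine h1.trans ?_
      nlinarith
    have h4 : 0 ≤ x ^ m := by positivity
    linarith
  have hZge : (m : ℝ) / n + x * w / n ≤ Z := by
    have h1 := pow_gap_ineq hm hxpos.le
    have h2 : Z = (1 - x ^ m) * (m - n * x) / (n * w) := by
      have h3 : (m : ℝ) - n * x = 1 + n * w := by rw [hmn, hwdef]; ring
      rw [hZ, h3]; field_simp; ring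
    rw [h2, le_div_iff₀ (by positivity)]
    have h3 : ((m : ℝ) / n + x * w / n) * (n * w) = w * (m + x * w) := by field_simp
    rw [h3]; exact h1
  have hZnn : 0 ≤ Z := le_trans (by positivity) hZge
  have hmain : (1 - y₁) ^ 2 * Z ≤ n * (1 - x ^ m) * (g₁ + g₂) := by
    refine le_trans (le_of_eq ?_) (mul_le_mul_of_nonneg_left hZ0 hfac)
    rw [hZ]; field_simp
  have hgain : x₀ / (4 * K * n ^ 3) ≤ x * w / n := by
    have : x₀ / (4 * K * n ^ 3) = x₀ * (1 / (4 * K * n ^ 2)) / n := by field_simp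
    rw [this]
    gcongr
  have hloss : Z - 6 * y₁ ≤ (1 - y₁) ^ 2 * Z := by
    nlinarith [mul_le_mul_of_nonneg_left hZle hy₁, mul_nonneg (sq_nonneg y₁) hZnn]
  linarith

/-! ### Consequences of one step for gap, spread and potential -/

open WeightedMoments

section Step

variable {m : ℕ} {s ε c : ℝ} {w w' : WeightedMoments}

lemma WeightedMoments.Admissible.A_eq (hw : w.Admissible m c) (hs : 1 < s) :
    w.A = (1 - w.gap s) * w.G / (s - 1) := by
  have hG : (0 : ℝ) < w.G := by linarith [hw.one_le]
  have : s - 1 ≠ 0 := by linarith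
  unfold gap
  field_simp
  ring

lemma WeightedMoments.Admissible.add_eq (hw : w.Admissible m c) :
    w.A + w.B = w.spread * w.G := by
  have hG : (0 : ℝ) < w.G := by linarith [hw.one_le]
  unfold spread
  field_simp

lemma WeightedMoments.Admissible.gap_mul (hw : w.Admissible m c) :
    w.gap s * w.G = w.G - (s - 1) * w.A := by
  have hG : (0 : ℝ) < w.G := by linarith [hw.one_le]
  unfold gap
  field_simp

lemma WeightedMoments.Admissible.spread_nonneg (hw : w.Admissible m c) : 0 ≤ w.spread := by
  have := hw.one_le; have := hw.A_nonneg; have := hw.A_le_B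
  unfold spread
  apply div_nonneg <;> linarith

/-- Unless the law is strongly supercritical, `G` is bounded uniformly in `s`. -/
lemma WeightedMoments.Admissible.G_bound (hw : w.Admissible m c) (hs : 4 / 3 ≤ s)
    (hgap : -1 ≤ w.gap s) : w.G ≤ 4 * (m : ℝ) ^ 8 := by
  have h := hw.gap_mul (s := s)
  have h1 := hw.G_le
  have h2 := hw.A_nonneg
  have h3 := hw.one_le
  nlinarith

/-- The normalised potential `gap + η * spread` is bounded below: when the gap is at most
`1 / 2`, `A / G` is bounded below and with it the spread. -/
lemma WeightedMoments.Admissible.potential_lower (hm : 2 ≤ m) (hw : w.Admissible m c)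
    (hs : 1 < s) (hsm : s ≤ m) {η : ℝ} (hη : 0 < η) (hη1 : η ≤ 1)
    (hgap : -(η / (2 * (m - 1))) ≤ w.gap s) :
    η / (2 * (m - 1)) ≤ w.gap s + η * w.spread := by
  have hm' : (2 : ℝ) ≤ m := by exact_mod_cast hm
  have hr := hw.spread_nonneg
  have hG : (0 : ℝ) < w.G := by linarith [hw.one_le]
  by_cases hy : w.gap s ≤ 1 / 2
  · have h1 : 2 * (w.A / w.G) ≤ w.spread := by
      unfold spread
      rw [← mul_div_assoc]
      gcongr
      linarith [hw.A_le_B]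
    have h2 : 1 / (2 * (m - 1)) ≤ w.A / w.G := by
      rw [hw.A_eq hs]
      have : (1 - w.gap s) * w.G / (s - 1) / w.G = (1 - w.gap s) / (s - 1) := by
        have : s - 1 ≠ 0 := by linarith
        field_simp
      rw [this, div_le_div_iff₀ (by linarith) (by linarith)]
      nlinarith
    have h3 : η * (1 / (m - 1)) ≤ η * w.spread := by
      gcongr
      refine le_trans (le_of_eq ?_) ((mul_le_mul_of_nonneg_left h2 zero_le_two).trans h1)
      have : (m : ℝ) - 1 ≠ 0 := by linarith
      field_simp
    have h4 : η * (1 / ((m : ℝ) - 1)) = η / (2 * (m - 1)) + η / (2 * (m - 1)) := by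
      have : (m : ℝ) - 1 ≠ 0 := by linarith
      field_simp; norm_num
    linarith
  · have : η / (2 * ((m : ℝ) - 1)) ≤ 1 / 2 := by
      rw [div_le_div_iff₀ (by linarith) (by norm_num)]
      nlinarith
    have : 0 ≤ η * w.spread := by positivity
    linarith

lemma WeightedMoments.StepRel.mass_le_pow (h : StepRel m s ε w w') (hw : w.Admissible m c)
    (hc : 0 ≤ c) (hs : 1 ≤ s) : w'.G ≤ w.G ^ m := by
  have h1 : w.q ^ m ≤ w.G ^ m :=
    pow_le_pow_left₀ (hc.trans hw.le_q) (hw.q_le.trans hw.one_le) m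
  have h2 : 0 ≤ 1 - 1 / s := by
    rw [sub_nonneg, div_le_one (by linarith)]; exact hs
  calc w'.G ≤ _ := h.mass_le
    _ ≤ w.G ^ m / s + (1 - 1 / s) * w.G ^ m := by gcongr
    _ = w.G ^ m := by ring

/-- The gap decreases by at most `m / s - 1` per step. -/
lemma WeightedMoments.StepRel.gap_drop (hm : 1 ≤ m) (h : StepRel m s ε w w')
    (hw : w.Admissible m c) (hw' : w'.Admissible m c) (hc : 0 ≤ c) (hs : 1 < s) (hsm : s ≤ m)
    (hy : m / s - 1 ≤ w.gap s) : w.gap s - (m / s - 1) ≤ w'.gap s := by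
  have hG : (0 : ℝ) < w.G := by linarith [hw.one_le]
  have hG' : (0 : ℝ) < w'.G := by linarith [hw'.one_le]
  have ha : 1 ≤ m / s := by rw [one_le_div (by linarith)]; exact hsm
  have hle := h.mass_le_pow hw hc hs.le
  have hpow : w.G ^ m = w.G ^ (m - 1) * w.G := by rw [← pow_succ, Nat.sub_add_cancel hm]
  have h1 : w.G ^ m * (m / s * w.gap s - (m / s - 1)) ≤ w'.gap s * w'.G := by
    rw [hw'.gap_mul]
    have h2 := h.drift_le
    have h3 : w.G ^ m * (m / s * w.gap s - (m / s - 1))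
        = w.G ^ m - m / s * (s - 1) * w.A * w.G ^ (m - 1) := by
      have := hw.gap_mul (s := s)
      rw [hpow]
      linear_combination (w.G ^ (m - 1) * (m / s)) * this
    linarith
  have h4 : w.gap s - (m / s - 1) ≤ m / s * w.gap s - (m / s - 1) := by nlinarith
  have h5 : 0 ≤ w.gap s - (m / s - 1) := by linarith
  have h6 : w'.G * (w.gap s - (m / s - 1)) ≤ w'.gap s * w'.G := by
    refine le_trans ?_ h1
    exact mul_le_mul hle h4 h5 (by positivity)
  nlinarith

lemma WeightedMoments.StepRel.le_second_of_spread (hm : 2 ≤ m) (h : StepRel m s ε w w')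
    (hw : w.Admissible m c) (hs : 0 < s) :
    m / s * w.G ^ m * (w.spread - 1 / (m - 1)) - ε ≤ w'.A + w'.B := by
  refine le_trans (sub_le_sub_right ?_ ε) h.le_second
  have hm' : (2 : ℝ) ≤ m := by exact_mod_cast hm
  have hn : (0 : ℝ) < (m : ℝ) - 1 := by linarith
  have hG : (0 : ℝ) < w.G := by linarith [hw.one_le]
  have hpow : w.G ^ m = w.G ^ (m - 1) * w.G := by
    rw [← pow_succ, Nat.sub_add_cancel (by omega)]
  rw [hpow, mul_assoc (_ / _), mul_assoc (_ / _), mul_assoc]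
  gcongr
  have h1 := hw.add_eq
  -- arithmetic-geometric mean inequality
  have h2 : 0 ≤ (m - 1) * (w.A - w.G / (m - 1)) ^ 2 / w.G := by positivity
  have h3 : (m - 1) * (w.A - w.G / (m - 1)) ^ 2 / w.G
      = (m - 1) * w.A ^ 2 / w.G - 2 * w.A + w.G * (1 / (m - 1)) := by
    field_simp; ring
  rw [h3] at h2
  nlinarith

lemma WeightedMoments.StepRel.spread_drop (hm : 2 ≤ m) (h : StepRel m s ε w w')
    (hw : w.Admissible m c) (hw' : w'.Admissible m c) (hc : 0 ≤ c) (hs : 1 < s) (hsm : s ≤ m)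
    (hε : ε ≤ 1) (hr : 2 ≤ w.spread) : w.spread - 2 ≤ w'.spread := by
  have hm' : (2 : ℝ) ≤ m := by exact_mod_cast hm
  have hG' : (0 : ℝ) < w'.G := by linarith [hw'.one_le]
  have hGm : 1 ≤ w.G ^ m := one_le_pow₀ hw.one_le
  have ha : 1 ≤ m / s := by rw [one_le_div (by linarith)]; exact hsm
  have hle := h.mass_le_pow hw hc hs.le
  have h1 := h.le_second_of_spread hm hw (by linarith)
  have hinv : 1 / ((m : ℝ) - 1) ≤ 1 := by rw [div_le_one (by linarith)]; linarith
  have h2 : w.G ^ m * (w.spread - 1) ≤ m / s * w.G ^ m * (w.spread - 1 / (m - 1)) := by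
    have : 1 * w.G ^ m ≤ m / s * w.G ^ m := by gcongr
    rw [one_mul] at this
    exact mul_le_mul this (by linarith) (by linarith) (by positivity)
  have h3 : w.G ^ m * (w.spread - 2) ≤ w'.spread * w'.G := by
    rw [← hw'.add_eq]; nlinarith
  have h4 : w'.G * (w.spread - 2) ≤ w.G ^ m * (w.spread - 2) :=
    mul_le_mul_of_nonneg_right hle (by linarith)
  nlinarith

/-- At a nearly critical step with moderate spread, the spread increases by a fixed amount. -/
lemma WeightedMoments.StepRel.spread_growth (hm : 2 ≤ m) (h : StepRel m s ε w w')
    (hw : w.Admissible m c) (hw' : w'.Admissible m c) (hc : 0 < c) (hs : 4 / 3 ≤ s) (hsm : s ≤ m)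
    (hε : 0 ≤ ε) {y₁ K γ : ℝ} (hy₁' : y₁ ≤ 1 / 2) (hy : |w.gap s| ≤ y₁)
    (hr : w.spread ≤ K) (hγ : 0 ≤ γ)
    (hgain : 6 * y₁ + m * ε + m * γ ≤ c / (4 * (m : ℝ) ^ 8) / (4 * K * (m - 1) ^ 3)) :
    w.spread + γ ≤ w'.spread := by
  have hm' : (2 : ℝ) ≤ m := by exact_mod_cast hm
  have hG : (0 : ℝ) < w.G := by linarith [hw.one_le]
  have hG' : (0 : ℝ) < w'.G := by linarith [hw'.one_le]
  have hs0 : 0 < s := by linarith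
  have hn : (0 : ℝ) < (m : ℝ) - 1 := by linarith
  have hGm : 1 ≤ w.G ^ m := one_le_pow₀ hw.one_le
  obtain ⟨hyl, hyu⟩ := abs_le.mp hy
  have hy₁ : 0 ≤ y₁ := (abs_nonneg _).trans hy
  have hGb := hw.G_bound hs (by linarith)
  set x := w.q / w.G with hx
  have hxl : c / (4 * (m : ℝ) ^ 8) ≤ x := by
    rw [hx]; exact div_le_div₀ (hc.le.trans hw.le_q) hw.le_q hG hGb
  have hx0 : 0 ≤ x := le_trans (by positivity) hxl
  have hx1 : x ≤ 1 := by rw [hx, div_le_one hG]; exact hw.q_le.trans hw.one_le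
  have hg1 : (1 - y₁) / (m - 1) ≤ w.A / w.G := by
    have : w.A / w.G = (1 - w.gap s) / (s - 1) := by
      have : s - 1 ≠ 0 := by linarith
      rw [hw.A_eq (s := s) (by linarith)]; field_simp
    rw [this]
    apply div_le_div₀ <;> linarith
  have hcs : (w.A / w.G) ^ 2 ≤ w.B / w.G * (1 - x) := by
    have : w.B / w.G * (1 - x) = w.B * (w.G - w.q) / w.G ^ 2 := by rw [hx]; field_simp
    rw [this, div_pow]
    gcongr
    exact hw.sq_le
  have hsum : w.A / w.G + w.B / w.G = w.spread := by unfold spread; rw [add_div]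
  have key := spread_gain (K := K) hm (by positivity) hxl hx1 hy₁ hy₁' hg1 hcs
    (by rw [hsum]; exact hr)
  rw [hsum] at key
  have h1 := h.le_second_of_spread hm hw hs0
  have hmass : w'.G ≤ w.G ^ m / s * (1 + (m - 1) * x ^ m) := by
    refine h.mass_le.trans ?_
    have : (1 - 1 / s) * w.q ^ m = w.G ^ m / s * ((s - 1) * x ^ m) := by
      rw [hx, div_pow]; field_simp
    rw [this, mul_add, mul_one]
    gcongr
  have hr0 := hw.spread_nonneg
  have hxm : x ^ m ≤ 1 := pow_le_one₀ hx0 hx1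
  have hbig : (w.spread + γ) * (1 + (m - 1) * x ^ m) ≤ m * (w.spread - 1 / (m - 1)) - m * ε := by
    have e1 : (m : ℝ) * (1 / (m - 1)) = m / (m - 1) := by ring
    have e2 : γ * (1 + (m - 1) * x ^ m) ≤ m * γ := by nlinarith [mul_nonneg hγ hn.le]
    nlinarith
  have hfin : (w.spread + γ) * w'.G ≤ w'.spread * w'.G := by
    rw [← hw'.add_eq]
    refine le_trans ?_ h1
    calc (w.spread + γ) * w'.G ≤ (w.spread + γ) * (w.G ^ m / s * (1 + (m - 1) * x ^ m)) := by
          gcongr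
      _ = w.G ^ m / s * ((w.spread + γ) * (1 + (m - 1) * x ^ m)) := by ring
      _ ≤ w.G ^ m / s * (m * (w.spread - 1 / (m - 1)) - m * ε) := by gcongr
      _ = m / s * w.G ^ m * (w.spread - 1 / (m - 1)) - w.G ^ m * (m / s) * ε := by ring
      _ ≤ _ := by
          gcongr
          have ha : 1 ≤ m / s := by rw [one_le_div (by linarith)]; exact hsm
          have : 1 * 1 ≤ w.G ^ m * (m / s) := mul_le_mul hGm ha zero_le_one (by linarith)
          nlinarith
  exact le_of_mul_le_mul_right hfin hG'

/-- The potential `G * (gap + η * spread)` grows like the product, up to a loss `3 * η * G`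
which is relatively small as soon as the normalised potential is large compared with `η`. -/
lemma WeightedMoments.StepRel.potential_step (hm : 2 ≤ m) (h : StepRel m s ε w w')
    (hw : w.Admissible m c) (hw' : w'.Admissible m c) (hs : 1 < s) (hsm : s ≤ m)
    (hε : ε ≤ 1) {η : ℝ} (hη : 0 < η) (hτ : m / s - 1 ≤ η)
    (hΦ : 3 * η ≤ w.gap s + η * w.spread) :
    w.G ^ m * (w.gap s + η * w.spread - 3 * η) ≤ w'.G * (w'.gap s + η * w'.spread) := by
  have hm' : (2 : ℝ) ≤ m := by exact_mod_cast hm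
  have hGm : 1 ≤ w.G ^ m := one_le_pow₀ hw.one_le
  have ha : 1 ≤ m / s := by rw [one_le_div (by linarith)]; exact hsm
  have hpow : w.G ^ m = w.G ^ (m - 1) * w.G := by
    rw [← pow_succ, Nat.sub_add_cancel (by omega)]
  have h1 := h.le_second_of_spread hm hw (by linarith)
  have h2 : w.G ^ m * (m / s * w.gap s - (m / s - 1)) ≤ w'.G * w'.gap s := by
    have h2 := h.drift_le
    have h3 : w.G ^ m * (m / s * w.gap s - (m / s - 1))
        = w.G ^ m - m / s * (s - 1) * w.A * w.G ^ (m - 1) := by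
      have := hw.gap_mul (s := s)
      rw [hpow]
      linear_combination (w.G ^ (m - 1) * (m / s)) * this
    have := hw'.gap_mul (s := s)
    linarith
  have hinv : 1 / ((m : ℝ) - 1) ≤ 1 := by rw [div_le_one (by linarith)]; linarith
  have h4 : w'.G * (w'.gap s + η * w'.spread) = w'.G * w'.gap s + η * (w'.A + w'.B) := by
    rw [hw'.add_eq]; ring
  rw [h4]
  have h5 : η * (m / s * w.G ^ m * (w.spread - 1 / (m - 1)) - ε) ≤ η * (w'.A + w'.B) := by
    gcongr
  have h6 : w.G ^ m * (w.gap s + η * w.spread - 3 * η) ≤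
      w.G ^ m * (m / s * (w.gap s + η * w.spread) - (m / s - 1) - m / s * η * (1 / (m - 1))
        - η) := by
    refine mul_le_mul_of_nonneg_left ?_ (by positivity)
    have : 1 * (w.gap s + η * w.spread - η) ≤ m / s * (w.gap s + η * w.spread - η) :=
      mul_le_mul_of_nonneg_right ha (by linarith)
    have h7 : m / s * η * (1 / ((m : ℝ) - 1)) ≤ m / s * η * 1 := by gcongr
    nlinarith
  have h8 : η * ε ≤ w.G ^ m * η := by nlinarith
  linarith

end Step

/-! ### The Lyapunov function and the bound on the product -/

/-- Compatibility of the constants: `θ` is the growth rate aimed at, `K` the spread above which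
`potential_step` loses at most a factor `1 - θ`, `η` the weight of the spread in the potential,
`γ` the gain of spread at a nearly critical step, and `Λ` the weight of the budget. A gap above
`3 * η / θ` also makes `potential_step` efficient, and `6 * η / θ` limits the nearly critical
range. -/
structure Tuning (m : ℕ) (c θ s ε K η γ Λ : ℝ) : Prop where
  hm : 2 ≤ m
  c_pos : 0 < c
  θ_pos : 0 < θ
  θ_le : θ ≤ 1 / 2
  K_eq : K = 3 / θ + 1
  η_pos : 0 < η
  η_le : η ≤ θ / 12
  γ_pos : 0 < γ
  γ_le : γ ≤ 1
  ε_nonneg : 0 ≤ ε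
  ε_le : ε ≤ 1
  ε_le_ratio : ε ≤ m / s - 1
  gain : 6 * (6 * η / θ) + m * ε + m * γ ≤
    c / (4 * (m : ℝ) ^ 8) / (4 * (K + 3) * (m - 1) ^ 3)
  Λ_nonneg : 0 ≤ Λ
  loss : (4 * (m : ℝ) ^ 8) ^ m * (3 / θ + K) * (2 * (m - 1)) ≤ Real.exp (Λ * γ)
  ratio_le : m / s - 1 ≤ η
  drop : Λ * ((K + γ) * ((m / s - 1) / (3 * η / θ))) ≤ θ
  le_s : 4 / 3 ≤ s
  s_le : s ≤ m

/-- The constants are chosen in the order `K`, `η`, `γ`, `Λ`, then `s` close to `m`, then `ε`. -/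
lemma exists_tuning {m : ℕ} (hm : 2 ≤ m) {c θ : ℝ} (hc : 0 < c) (hθ : 0 < θ) (hθ' : θ ≤ 1 / 2) :
    ∃ K η γ Λ τ : ℝ, 0 < τ ∧ ∀ s : ℝ, 4 / 3 ≤ s → s < m → m / s - 1 ≤ τ →
      ∃ ε : ℝ, 0 < ε ∧ Tuning m c θ s ε K η γ Λ := by
  have hm' : (2 : ℝ) ≤ m := by exact_mod_cast hm
  have hn : (0 : ℝ) < (m : ℝ) - 1 := by linarith
  obtain ⟨K, hK⟩ : ∃ K : ℝ, K = 3 / θ + 1 := ⟨_, rfl⟩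
  have hKpos : 0 < K := by rw [hK]; positivity
  obtain ⟨g, hg⟩ : ∃ g : ℝ, g = c / (4 * (m : ℝ) ^ 8) / (4 * (K + 3) * (m - 1) ^ 3) := ⟨_, rfl⟩
  have hgpos : 0 < g := by rw [hg]; positivity
  obtain ⟨η, hη⟩ : ∃ η : ℝ, η = min (θ / 12) (θ * g / 108) := ⟨_, rfl⟩
  have hηpos : 0 < η := by rw [hη]; apply lt_min <;> positivity
  obtain ⟨γ, hγ⟩ : ∃ γ : ℝ, γ = min 1 (g / (3 * m)) := ⟨_, rfl⟩
  have hγpos : 0 < γ := by rw [hγ]; apply lt_min <;> positivity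
  obtain ⟨X, hX⟩ : ∃ X : ℝ, X = (4 * (m : ℝ) ^ 8) ^ m * (3 / θ + K) * (2 * (m - 1)) := ⟨_, rfl⟩
  have hXpos : 0 < X := by rw [hX]; positivity
  obtain ⟨Λ, hΛ⟩ : ∃ Λ : ℝ, Λ = X / γ := ⟨_, rfl⟩
  have hΛpos : 0 < Λ := by rw [hΛ]; positivity
  refine ⟨K, η, γ, Λ, min η (θ * (3 * η / θ) / (Λ * (K + γ))), ?_, fun s hs hsm hτ => ?_⟩
  · apply lt_min hηpos; positivity
  have hs0 : 0 < s := by linarith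
  have hτpos : 0 < m / s - 1 := by rw [sub_pos, one_lt_div hs0]; exact hsm
  refine ⟨min 1 (min (m / s - 1) (g / (3 * m))), ?_, ?_⟩
  · refine lt_min one_pos (lt_min hτpos (by positivity))
  refine ⟨hm, hc, hθ, hθ', hK, hηpos, ?_, hγpos, ?_, ?_, min_le_left _ _,
    (min_le_right _ _).trans (min_le_left _ _), ?_, hΛpos.le, ?_, hτ.trans (min_le_left _ _), ?_,
    hs, hsm.le⟩
  · rw [hη]; exact min_le_left _ _
  · rw [hγ]; exact min_le_left _ _
  · exact le_min zero_le_one (le_min hτpos.le (by positivity))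
  · rw [← hg]
    have h1 : 6 * (6 * η / θ) ≤ g / 3 := by
      have : η ≤ θ * g / 108 := by rw [hη]; exact min_le_right _ _
      calc 6 * (6 * η / θ) ≤ 6 * (6 * (θ * g / 108) / θ) := by gcongr
        _ = g / 3 := by field_simp; norm_num
    have h2 : ∀ t, t ≤ g / (3 * m) → m * t ≤ g / 3 := fun t ht => by
      calc (m : ℝ) * t ≤ m * (g / (3 * m)) := by gcongr
        _ = g / 3 := by field_simp
    have h3 := h2 (min 1 (min (m / s - 1) (g / (3 * m))))
      ((min_le_right _ _).trans (min_le_right _ _))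
    have h4 := h2 γ (by rw [hγ]; exact min_le_right _ _)
    linarith
  · rw [← hX, hΛ, div_mul_cancel₀ _ hγpos.ne']
    linarith [Real.add_one_le_exp X]
  · have h1 : m / s - 1 ≤ θ * (3 * η / θ) / (Λ * (K + γ)) := hτ.trans (min_le_right _ _)
    calc Λ * ((K + γ) * ((m / s - 1) / (3 * η / θ)))
        ≤ Λ * ((K + γ) * ((θ * (3 * η / θ) / (Λ * (K + γ))) / (3 * η / θ))) := by gcongr
      _ = θ := by field_simp

/-- A quantity in `[0, K]` that increases by a fixed amount at each inefficient step and decreases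
only slightly at the others. The spread pays for the inefficient steps; as it may collapse while
the gap is large, a gap above `2 * y₀` is given the full budget `K`, which the gap hands back to the
spread as it slowly returns to the nearly critical range. -/
noncomputable def budget (y₀ K y r : ℝ) : ℝ :=
  max (min r K) (K * max 0 (min 1 ((y - y₀) / y₀)))

lemma budget_nonneg {y₀ K y r : ℝ} (hK : 0 ≤ K) : 0 ≤ budget y₀ K y r :=
  le_max_of_le_right (mul_nonneg hK (le_max_left _ _))

lemma budget_le {y₀ K y r : ℝ} (hK : 0 ≤ K) : budget y₀ K y r ≤ K := by
  refine max_le (min_le_right _ _) ?_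
  have : max 0 (min 1 ((y - y₀) / y₀)) ≤ 1 := max_le zero_le_one (min_le_left _ _)
  nlinarith

section

variable {m : ℕ} {c θ s ε K η γ Λ : ℝ} {w w' : WeightedMoments}

lemma Tuning.spread_step (hT : Tuning m c θ s ε K η γ Λ) (h : StepRel m s ε w w')
    (hw : w.Admissible m c) (hw' : w'.Admissible m c) (hy : |w.gap s| ≤ 6 * η / θ) :
    min (w.spread + γ) (K + γ) ≤ w'.spread := by
  have hθ := hT.θ_pos
  have hK : 1 ≤ K := by
    rw [hT.K_eq]
    exact le_add_of_nonneg_left (by positivity)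
  rcases le_total w.spread (K + 3) with hr | hr
  · refine (min_le_left _ _).trans ?_
    refine h.spread_growth hT.hm hw hw' hT.c_pos hT.le_s hT.s_le hT.ε_nonneg (y₁ := 6 * η / θ) ?_
      hy hr hT.γ_pos.le hT.gain
    rw [div_le_iff₀ hT.θ_pos]; linarith [hT.η_le]
  · refine (min_le_right _ _).trans ?_
    have := h.spread_drop hT.hm hw hw' hT.c_pos.le (by linarith [hT.le_s]) hT.s_le hT.ε_le
      (by linarith)
    linarith [hT.γ_le]

lemma Tuning.budget_step (hT : Tuning m c θ s ε K η γ Λ) (h : StepRel m s ε w w')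
    (hw : w.Admissible m c) (hw' : w'.Admissible m c)
    (hy : -(η / (2 * (m - 1))) ≤ w.gap s) :
    budget (3 * η / θ) (K + γ) (w.gap s) w.spread
        - (K + γ) * ((m / s - 1) / (3 * η / θ)) ≤
      budget (3 * η / θ) (K + γ) (w'.gap s) w'.spread := by
  have hm' : (2 : ℝ) ≤ m := by exact_mod_cast hT.hm
  have hθ := hT.θ_pos
  have hη := hT.η_pos
  have hγ := hT.γ_pos
  set y₀ := 3 * η / θ with hy₀
  have hy₀pos : 0 < y₀ := by positivity
  have hηy₀ : η ≤ y₀ := by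
    rw [hy₀, le_div_iff₀ hθ]; nlinarith [hT.θ_le]
  have h2y₀ : 6 * η / θ = 2 * y₀ := by rw [hy₀]; ring
  have hK : 0 < K := by rw [hT.K_eq]; positivity
  clear_value y₀
  have hτ : 0 ≤ m / s - 1 := hT.ε_nonneg.trans hT.ε_le_ratio
  have hτy : m / s - 1 ≤ y₀ := hT.ratio_le.trans hηy₀
  have hd : 0 ≤ (K + γ) * ((m / s - 1) / y₀) := by positivity
  have hclamp : (K + γ) * max 0 (min 1 ((w.gap s - y₀) / y₀)) - (K + γ) * ((m / s - 1) / y₀) ≤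
      (K + γ) * max 0 (min 1 ((w'.gap s - y₀) / y₀)) := by
    rw [← mul_sub]
    refine mul_le_mul_of_nonneg_left ?_ (by positivity)
    have ht : 0 ≤ (m / s - 1) / y₀ := by positivity
    rcases le_total (w.gap s) y₀ with h1 | h1
    · have : (w.gap s - y₀) / y₀ ≤ 0 := div_nonpos_of_nonpos_of_nonneg (by linarith) hy₀pos.le
      rw [max_eq_left ((min_le_right _ _).trans this)]
      exact le_trans (by linarith) (le_max_left _ _)
    · have h2 := h.gap_drop (by linarith [hT.hm]) hw hw' hT.c_pos.le (by linarith [hT.le_s])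
        hT.s_le (by linarith)
      have h3 : (w.gap s - y₀) / y₀ - (m / s - 1) / y₀ ≤ (w'.gap s - y₀) / y₀ := by
        rw [← sub_div]; exact div_le_div_of_nonneg_right (by linarith) hy₀pos.le
      rw [sub_le_iff_le_add]
      refine max_le (by positivity) ?_
      have h4 : min 1 ((w.gap s - y₀) / y₀) ≤ min 1 ((w'.gap s - y₀) / y₀) + (m / s - 1) / y₀ := by
        rw [← min_add_add_right]
        exact min_le_min (by linarith) (by linarith)
      exact h4.trans (by gcongr; exact le_max_right _ _)
  unfold budget
  rw [sub_le_iff_le_add]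
  refine max_le ?_ ?_
  · rcases le_total (w.gap s) (2 * y₀) with h1 | h1
    · have hyabs : |w.gap s| ≤ 6 * η / θ := by
        rw [h2y₀, abs_le]
        refine ⟨?_, h1⟩
        have : η / (2 * ((m : ℝ) - 1)) ≤ η := div_le_self hη.le (by linarith)
        linarith
      have h2 := hT.spread_step h hw hw' hyabs
      have h3 : min w.spread (K + γ) ≤ min w'.spread (K + γ) := by
        refine le_min (le_trans (min_le_min (by linarith) le_rfl) h2) (min_le_right _ _)
      exact h3.trans ((le_max_left _ _).trans (by linarith))
    · have h2 : 1 ≤ (w.gap s - y₀) / y₀ := by rw [le_div_iff₀ hy₀pos]; linarith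
      rw [min_eq_left h2, max_eq_right zero_le_one, mul_one] at hclamp
      refine (min_le_right _ _).trans ?_
      have := le_max_right (min w'.spread (K + γ))
        ((K + γ) * max 0 (min 1 ((w'.gap s - y₀) / y₀)))
      linarith
  · have := le_max_right (min w'.spread (K + γ)) ((K + γ) * max 0 (min 1 ((w'.gap s - y₀) / y₀)))
    linarith

/-- The potential `G * (gap + η * spread)`, corrected by the exponential of the budget. -/
noncomputable def lyapunov (θ s K η γ Λ : ℝ) (w : WeightedMoments) : ℝ :=
  w.G * (w.gap s + η * w.spread) *
    Real.exp (Λ * budget (3 * η / θ) (K + γ) (w.gap s) w.spread)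

lemma Tuning.lyapunov_step (hT : Tuning m c θ s ε K η γ Λ) (h : StepRel m s ε w w')
    (hw : w.Admissible m c) (hw' : w'.Admissible m c)
    (hy : -(η / (2 * (m - 1))) ≤ w.gap s) (hy' : -(η / (2 * (m - 1))) ≤ w'.gap s) :
    Real.exp (-(3 * θ)) * (w.G ^ (m - 1) * lyapunov θ s K η γ Λ w) ≤
      lyapunov θ s K η γ Λ w' := by
  have hm' : (2 : ℝ) ≤ m := by exact_mod_cast hT.hm
  have hθ := hT.θ_pos
  have hη := hT.η_pos
  have hγ := hT.γ_pos
  have hs : 1 < s := by linarith [hT.le_s]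
  have hK : 0 < K := by rw [hT.K_eq]; positivity
  have hη1 : η ≤ 1 := by linarith [hT.η_le, hT.θ_le]
  have hpow : w.G ^ m = w.G ^ (m - 1) * w.G := by
    rw [← pow_succ, Nat.sub_add_cancel (by linarith [hT.hm])]
  have hGm : 1 ≤ w.G ^ m := one_le_pow₀ hw.one_le
  have hlow := hw.potential_lower hT.hm hs hT.s_le hη hη1 hy
  have hlow' := hw'.potential_lower hT.hm hs hT.s_le hη hη1 hy'
  have hηm : 0 < η / (2 * ((m : ℝ) - 1)) := div_pos hη (by linarith)
  set φ := w.gap s + η * w.spread with hφ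
  set φ' := w'.gap s + η * w'.spread with hφ'
  set P := budget (3 * η / θ) (K + γ) (w.gap s) w.spread with hP
  set P' := budget (3 * η / θ) (K + γ) (w'.gap s) w'.spread with hP'
  have hG' := hw'.one_le
  have goal_eq : Real.exp (-(3 * θ)) * (w.G ^ (m - 1) * lyapunov θ s K η γ Λ w)
      = Real.exp (-(3 * θ)) * (w.G ^ m * φ * Real.exp (Λ * P)) := by
    rw [lyapunov, hpow]; ring
  rw [goal_eq, lyapunov, ← hφ', ← hP']
  have hφpos : 0 < φ := by linarith
  have hφ'pos : 0 < φ' := by linarith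
  -- the step is efficient if the normalised potential is at least `3 * η / θ`
  by_cases hgood : 3 * η ≤ θ * φ
  · have h1 : (1 - θ) * (w.G ^ m * φ) ≤ w'.G * φ' := by
      have h2 := h.potential_step hT.hm hw hw' hs hT.s_le hT.ε_le hη hT.ratio_le
        (by rw [← hφ]; nlinarith [hT.θ_le])
      refine le_trans ?_ h2
      nlinarith
    have h2 : Real.exp (-θ) * Real.exp (Λ * P) ≤ Real.exp (Λ * P') := by
      rw [← Real.exp_add, Real.exp_le_exp]
      have h3 := hT.budget_step h hw hw' hy
      have h4 := mul_le_mul_of_nonneg_left h3 hT.Λ_nonneg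
      rw [mul_sub] at h4
      rw [neg_add_eq_sub]
      exact (sub_le_sub_left hT.drop _).trans h4
    have h3 : Real.exp (-(2 * θ)) ≤ 1 - θ := by
      rw [Real.exp_neg, inv_le_comm₀ (Real.exp_pos _) (by linarith [hT.θ_le])]
      refine le_trans ?_ (Real.add_one_le_exp (2 * θ))
      rw [inv_eq_one_div, div_le_iff₀ (by linarith [hT.θ_le])]
      nlinarith [hT.θ_le]
    calc Real.exp (-(3 * θ)) * (w.G ^ m * φ * Real.exp (Λ * P))
        = (Real.exp (-(2 * θ)) * (w.G ^ m * φ)) * (Real.exp (-θ) * Real.exp (Λ * P)) := by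
          rw [show -(3 * θ) = -(2 * θ) + -θ by ring, Real.exp_add]; ring
      _ ≤ ((1 - θ) * (w.G ^ m * φ)) * Real.exp (Λ * P') := by
          have : 0 ≤ (1 - θ) * (w.G ^ m * φ) :=
            mul_nonneg (by linarith [hT.θ_le]) (by positivity)
          gcongr
      _ ≤ w'.G * φ' * Real.exp (Λ * P') := by gcongr
  · push Not at hgood
    have hφlt : φ < 3 * η / θ := by rw [lt_div_iff₀ hθ]; linarith
    have hr0 := hw.spread_nonneg
    have hylt : w.gap s < 3 * η / θ := by
      have : 0 ≤ η * w.spread := by positivity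
      linarith
    have hηmη : η / (2 * ((m : ℝ) - 1)) ≤ η := div_le_self hη.le (by linarith)
    have hrlt : w.spread < K := by
      have h1 : η * w.spread < η * K := by
        rw [hT.K_eq, mul_add, mul_one, ← mul_div_assoc, mul_comm η 3]; linarith
      exact lt_of_mul_lt_mul_left h1 hη.le
    have hyabs : |w.gap s| ≤ 6 * η / θ := by
      have h3 : 6 * η / θ = 2 * (3 * η / θ) := by ring
      have h4 : η ≤ 3 * η / θ := by rw [le_div_iff₀ hθ]; nlinarith [hT.θ_le]
      rw [abs_le]; constructor <;> linarith
    -- at an inefficient step the budget equals the spread, which increases by `γ`; the factor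
    -- `exp (Λ * γ)` outweighs `G ^ m` and the possible loss of potential
    have hP1 : P = w.spread := by
      have : (w.gap s - 3 * η / θ) / (3 * η / θ) ≤ 0 :=
        div_nonpos_of_nonpos_of_nonneg (by linarith) (by positivity)
      rw [hP, budget, max_eq_left ((min_le_right _ _).trans this), mul_zero,
        min_eq_left (by linarith), max_eq_left hr0]
    have hP2 : P + γ ≤ P' := by
      have h1 := hT.spread_step h hw hw' hyabs
      rw [min_eq_left (by linarith)] at h1
      rw [hP1, hP', budget]
      exact le_max_of_le_left (le_min h1 (by linarith))
    have hGb : w.G ^ m ≤ (4 * (m : ℝ) ^ 8) ^ m := by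
      have := hw.one_le
      gcongr
      exact hw.G_bound hT.le_s (by linarith)
    have hE1 : Real.exp (-(3 * θ)) ≤ 1 := by rw [Real.exp_le_one_iff]; linarith
    calc Real.exp (-(3 * θ)) * (w.G ^ m * φ * Real.exp (Λ * P))
        ≤ 1 * ((4 * (m : ℝ) ^ 8) ^ m * (3 * η / θ) * Real.exp (Λ * P)) := by gcongr
      _ ≤ 1 * ((4 * (m : ℝ) ^ 8) ^ m * (η * (3 / θ + K)) * Real.exp (Λ * P)) := by
          gcongr
          rw [mul_add, ← mul_div_assoc, mul_comm η 3]
          nlinarith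
      _ = (η / (2 * (m - 1))) * ((4 * (m : ℝ) ^ 8) ^ m * (3 / θ + K) * (2 * (m - 1)))
            * Real.exp (Λ * P) := by
          have : (m : ℝ) - 1 ≠ 0 := by linarith
          field_simp
      _ ≤ (η / (2 * (m - 1))) * Real.exp (Λ * γ) * Real.exp (Λ * P) := by
          gcongr; exact hT.loss
      _ = (1 * (η / (2 * (m - 1)))) * Real.exp (Λ * (P + γ)) := by
          rw [mul_add, Real.exp_add]; ring
      _ ≤ w'.G * φ' * Real.exp (Λ * P') := by
          have := hT.Λ_nonneg
          gcongr

/-- The product of the `G ^ (m - 1)` grows at most with the exponential rate `3 * θ`. -/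
theorem Tuning.prod_le (hT : Tuning m c θ s ε K η γ Λ) (D : ℝ) :
    ∃ C : ℝ, 0 < C ∧ ∀ (w : ℕ → WeightedMoments) (N : ℕ),
      (∀ i ≤ N, (w i).Admissible m c) → (∀ i ≤ N, (w i).G ≤ D) →
      (∀ i ≤ N, (w i).A + (w i).B ≤ D) → (∀ i < N, StepRel m s ε (w i) (w (i + 1))) →
      ∏ i ∈ Finset.range N, (w i).G ^ (m - 1) ≤ C * Real.exp (3 * θ * N) := by
  have hm' : (2 : ℝ) ≤ m := by exact_mod_cast hT.hm
  have hθ := hT.θ_pos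
  have hη := hT.η_pos
  have hγ := hT.γ_pos
  have hs : 1 < s := by linarith [hT.le_s]
  have hK : 0 < K := by rw [hT.K_eq]; positivity
  have hη1 : η ≤ 1 := by linarith [hT.η_le, hT.θ_le]
  have hηm : 0 < η / (2 * ((m : ℝ) - 1)) := div_pos hη (by linarith)
  obtain ⟨ℓ, hℓ⟩ : ∃ ℓ : ℝ, ℓ = η / (2 * ((m : ℝ) - 1)) := ⟨_, rfl⟩
  obtain ⟨D', hD', hDD'⟩ : ∃ D' : ℝ, 1 ≤ D' ∧ D ≤ D' := ⟨max 1 D, le_max_left _ _, le_max_right _ _⟩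
  obtain ⟨U, hU⟩ : ∃ U : ℝ, U = (2 * D') * Real.exp (Λ * (K + γ)) := ⟨_, rfl⟩
  have hUpos : 0 < U := by rw [hU]; positivity
  have hℓpos : 0 < ℓ := hℓ ▸ hηm
  have hℓ1 : ℓ ≤ 1 := by
    rw [hℓ]; exact (div_le_self hη.le (by linarith)).trans hη1
  obtain ⟨Q, hQ⟩ : ∃ Q : ℝ, Q = max 1 (U / ℓ * D' ^ (m - 1)) := ⟨_, rfl⟩
  have hQ1 : 1 ≤ Q := hQ ▸ le_max_left _ _
  have hΛ := hT.Λ_nonneg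
  refine ⟨U / ℓ + Q * (m * D') / ℓ, by positivity, fun w N hadm hG hAB hstep => ?_⟩
  have hlyL : ∀ n ≤ N, -ℓ ≤ (w n).gap s → ℓ ≤ lyapunov θ s K η γ Λ (w n) := by
    intro n hn hgap
    have h1 := (hadm n hn).potential_lower hT.hm hs hT.s_le hη hη1 (hℓ ▸ hgap)
    rw [← hℓ] at h1
    have h2 := (hadm n hn).one_le
    have h3 := budget_nonneg (y₀ := 3 * η / θ) (y := (w n).gap s) (r := (w n).spread)
      (show 0 ≤ K + γ by positivity)
    have h4 : 1 ≤ Real.exp (Λ * budget (3 * η / θ) (K + γ) ((w n).gap s) (w n).spread) :=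
      Real.one_le_exp (mul_nonneg hΛ h3)
    rw [lyapunov]
    calc ℓ = 1 * ℓ * 1 := by ring
      _ ≤ _ := by
        have : 0 ≤ (w n).gap s + η * (w n).spread := hℓpos.le.trans h1
        gcongr
  have hlyU : ∀ n ≤ N, -ℓ ≤ (w n).gap s → lyapunov θ s K η γ Λ (w n) ≤ U := by
    intro n hn hgap
    have h2 := (hadm n hn).one_le
    rw [lyapunov, hU]
    have h3 : (w n).G * ((w n).gap s + η * (w n).spread) ≤ 2 * D' := by
      have h1 := (hadm n hn).gap_mul (s := s)
      have h4 := (hadm n hn).add_eq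
      have h5 := (hadm n hn).A_nonneg
      have h6 : 0 ≤ (w n).A + (w n).B := by linarith [(hadm n hn).A_le_B]
      have h7 := hAB n hn
      have h8 := hG n hn
      calc (w n).G * ((w n).gap s + η * (w n).spread)
          = ((w n).G - (s - 1) * (w n).A) + η * ((w n).A + (w n).B) := by
            rw [← h1, h4]; ring
        _ ≤ 2 * D' := by nlinarith
    have h4 := budget_le (y₀ := 3 * η / θ) (y := (w n).gap s) (r := (w n).spread)
      (show 0 ≤ K + γ by positivity)
    gcongr
  -- up to the first time when the gap falls below `-ℓ` the Lyapunov function controls the product,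
  -- and from then on the positive drift does
  have hdich : ∀ n ≤ N,
      (-ℓ ≤ (w n).gap s ∧ (∏ i ∈ Finset.range n, (w i).G ^ (m - 1)) * ℓ ≤
        Real.exp (3 * θ * n) * lyapunov θ s K η γ Λ (w n)) ∨
      (0 < (s - 1) * (w n).A - (w n).G ∧ (∏ i ∈ Finset.range n, (w i).G ^ (m - 1)) * ℓ ≤
        Q * Real.exp (3 * θ * n) * ((s - 1) * (w n).A - (w n).G)) := by
    have hHgap : ∀ n ≤ N, (w n).gap s < -ℓ → ℓ ≤ (s - 1) * (w n).A - (w n).G := by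
      intro n hn hgap
      have h1 := (hadm n hn).gap_mul (s := s)
      have h2 := (hadm n hn).one_le
      nlinarith
    intro n
    induction n with
    | zero =>
      intro hn
      simp only [Finset.range_zero, Finset.prod_empty, Nat.cast_zero, mul_zero, Real.exp_zero,
        one_mul, mul_one]
      by_cases hgap : -ℓ ≤ (w 0).gap s
      · left
        refine ⟨hgap, ?_⟩
        exact hlyL 0 hn hgap
      · right
        have h1 := hHgap 0 hn (lt_of_not_ge hgap)
        exact ⟨hℓpos.trans_le h1, by nlinarith⟩
    | succ n ih =>
      intro hn
      have hn' : n ≤ N := by omega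
      have hst := hstep n (by omega)
      have hG1 := (hadm n hn').one_le
      have hGm1 : 1 ≤ (w n).G ^ (m - 1) := one_le_pow₀ hG1
      have hexp : Real.exp (3 * θ * (n + 1 : ℕ)) = Real.exp (3 * θ * n) * Real.exp (3 * θ) := by
        rw [← Real.exp_add]; push_cast; ring_nf
      have hexp1 : 1 ≤ Real.exp (3 * θ) := Real.one_le_exp (by positivity)
      rw [Finset.prod_range_succ, hexp]
      rcases ih hn' with ⟨hgap, hL⟩ | ⟨hpos, hL⟩
      · have hL' : (∏ i ∈ Finset.range n, (w i).G ^ (m - 1)) * (w n).G ^ (m - 1) * ℓ ≤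
            Real.exp (3 * θ * n) * ((w n).G ^ (m - 1) * lyapunov θ s K η γ Λ (w n)) := by
          have := mul_le_mul_of_nonneg_right hL (zero_le_one.trans hGm1)
          linarith
        by_cases hgap' : -ℓ ≤ (w (n + 1)).gap s
        · left
          refine ⟨hgap', hL'.trans ?_⟩
          have h1 := hT.lyapunov_step hst (hadm n hn') (hadm (n + 1) hn) (hℓ ▸ hgap) (hℓ ▸ hgap')
          rw [Real.exp_neg, inv_mul_le_iff₀ (Real.exp_pos _)] at h1
          refine (mul_le_mul_of_nonneg_left h1 (Real.exp_pos _).le).trans (le_of_eq ?_)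
          ring
        · right
          have h1 := hHgap (n + 1) hn (lt_of_not_ge hgap')
          refine ⟨hℓpos.trans_le h1, hL'.trans ?_⟩
          have h2 : U * D' ^ (m - 1) ≤ Q * ℓ := by
            have : U / ℓ * D' ^ (m - 1) ≤ Q := hQ ▸ le_max_right _ _
            calc U * D' ^ (m - 1) = U / ℓ * D' ^ (m - 1) * ℓ := by field_simp
              _ ≤ Q * ℓ := by gcongr
          calc Real.exp (3 * θ * n) * ((w n).G ^ (m - 1) * lyapunov θ s K η γ Λ (w n))
              ≤ Real.exp (3 * θ * n) * (D' ^ (m - 1) * U) := by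
                have := hℓpos.le.trans (hlyL n hn' hgap)
                gcongr
                · exact (hG n hn').trans hDD'
                · exact hlyU n hn' hgap
            _ = Real.exp (3 * θ * n) * 1 * (U * D' ^ (m - 1)) := by ring
            _ ≤ Real.exp (3 * θ * n) * Real.exp (3 * θ) *
                (Q * ((s - 1) * (w (n + 1)).A - (w (n + 1)).G)) := by
                refine mul_le_mul (by gcongr) (h2.trans (by gcongr)) (by positivity)
                  (by positivity)
            _ = _ := by ring
      · right
        have ha := hT.ε_le_ratio
        have hH : (w n).G ^ (m - 1) * ((s - 1) * (w n).A - (w n).G) ≤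
            (s - 1) * (w (n + 1)).A - (w (n + 1)).G := by
          refine le_trans ?_ hst.le_drift
          have hpow : (w n).G ^ m = (w n).G ^ (m - 1) * (w n).G := by
            rw [← pow_succ, Nat.sub_add_cancel (by linarith [hT.hm])]
          rw [hpow]
          have h1 : 0 ≤ (m / s - 1) * ((s - 1) * (w n).A - (w n).G) * (w n).G ^ (m - 1) := by
            have := hT.ε_nonneg
            have : 0 ≤ m / s - 1 := by linarith
            positivity
          have h2 : (m / s - 1) ≤ (m / s - 1) * ((w n).G ^ (m - 1) * (w n).G) := by
            have := hT.ε_nonneg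
            exact le_mul_of_one_le_right (by linarith) (one_le_mul_of_one_le_of_one_le hGm1 hG1)
          linarith
        refine ⟨lt_of_lt_of_le (by positivity) hH, ?_⟩
        calc (∏ i ∈ Finset.range n, (w i).G ^ (m - 1)) * (w n).G ^ (m - 1) * ℓ
            = ((∏ i ∈ Finset.range n, (w i).G ^ (m - 1)) * ℓ) * (w n).G ^ (m - 1) := by ring
          _ ≤ (Q * Real.exp (3 * θ * n) * ((s - 1) * (w n).A - (w n).G)) *
              (w n).G ^ (m - 1) := by gcongr
          _ = Q * (Real.exp (3 * θ * n) * 1) *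
              ((w n).G ^ (m - 1) * ((s - 1) * (w n).A - (w n).G)) := by ring
          _ ≤ Q * (Real.exp (3 * θ * n) * Real.exp (3 * θ)) *
              ((s - 1) * (w (n + 1)).A - (w (n + 1)).G) := by gcongr
  have hN := hadm N le_rfl
  have h0 : 0 < U / ℓ := by positivity
  have h1 : 0 ≤ Q * (m * D') / ℓ := by positivity
  rw [add_mul]
  have hexp0 := Real.exp_pos (3 * θ * N)
  rcases hdich N le_rfl with ⟨hgap, hL⟩ | ⟨hpos, hL⟩
  · have h2 := hlyU N le_rfl hgap
    have h3 : ∏ i ∈ Finset.range N, (w i).G ^ (m - 1) ≤ U / ℓ * Real.exp (3 * θ * N) := by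
      rw [div_mul_eq_mul_div, le_div_iff₀ hℓpos]
      refine hL.trans ?_
      rw [mul_comm]; gcongr
    nlinarith
  · have h2 : (s - 1) * (w N).A - (w N).G ≤ m * D' := by
      have h5 := hN.A_nonneg
      have h6 := hN.A_le_B
      have h7 := hAB N le_rfl
      have h8 := hN.one_le
      have : (s - 1) * (w N).A ≤ m * D' :=
        mul_le_mul (by linarith [hT.s_le]) (by linarith) h5 (by linarith)
      linarith
    have h3 : ∏ i ∈ Finset.range N, (w i).G ^ (m - 1) ≤
        Q * (m * D') / ℓ * Real.exp (3 * θ * N) := by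
      rw [div_mul_eq_mul_div, le_div_iff₀ hℓpos]
      refine hL.trans ?_
      calc _ ≤ Q * Real.exp (3 * θ * N) * (m * D') := by gcongr
        _ = _ := by ring
    nlinarith

end

/-! ### Expectations of sums of independent bounded variables -/

section Bounded

variable {Ω : Type*} [MeasurableSpace Ω] {P : Measure Ω} {U : Ω → ℕ} {K : ℕ}

lemma integrable_comp_of_le [IsFiniteMeasure P] (hU : Measurable U) (hK : ∀ ω, U ω ≤ K)
    (F : ℕ → ℝ) : Integrable (fun ω => F (U ω)) P := by
  refine Integrable.of_bound (C := ∑ k ∈ Finset.range (K + 1), |F k|)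
    ((measurable_of_countable F).comp hU).aestronglyMeasurable (ae_of_all _ fun ω => ?_)
  rw [Real.norm_eq_abs]
  exact Finset.single_le_sum (f := fun k => |F k|) (fun k _ => abs_nonneg _)
    (Finset.mem_range.mpr (Nat.lt_succ_of_le (hK ω)))

lemma integral_comp_eq_sum [IsFiniteMeasure P] (hU : Measurable U) (hK : ∀ ω, U ω ≤ K)
    (F : ℕ → ℝ) :
    ∫ ω, F (U ω) ∂P = ∑ k ∈ Finset.range (K + 1), P.real (U ⁻¹' {k}) * F k := by
  have h1 : ∀ ω, F (U ω) =
      ∑ k ∈ Finset.range (K + 1), (U ⁻¹' {k}).indicator (fun _ => F k) ω := by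
    intro ω
    rw [Finset.sum_eq_single (U ω)]
    · simp
    · intro k _ hk
      simp [Set.indicator, hk.symm]
    · intro h
      exact absurd (Finset.mem_range.mpr (Nat.lt_succ_of_le (hK ω))) h
  have hm : ∀ k, MeasurableSet (U ⁻¹' {k}) := fun k => hU (measurableSet_singleton k)
  simp_rw [h1]
  rw [integral_finsetSum _ fun k _ => (integrable_const _).indicator (hm k)]
  refine Finset.sum_congr rfl fun k _ => ?_
  rw [integral_indicator_const _ (hm k), smul_eq_mul]

lemma hasDerivAt_integral_pow [IsFiniteMeasure P] (hU : Measurable U) (hK : ∀ ω, U ω ≤ K)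
    (j : ℕ) {t : ℝ} (ht : t ≠ 0) :
    HasDerivAt (fun t : ℝ => ∫ ω, (U ω : ℝ) ^ j * t ^ U ω ∂P)
      ((∫ ω, (U ω : ℝ) ^ (j + 1) * t ^ U ω ∂P) / t) t := by
  have h1 : ∀ t : ℝ, ∫ ω, (U ω : ℝ) ^ j * t ^ U ω ∂P =
      ∑ k ∈ Finset.range (K + 1), P.real (U ⁻¹' {k}) * ((k : ℝ) ^ j * t ^ k) :=
    fun t => integral_comp_eq_sum hU hK (fun k => (k : ℝ) ^ j * t ^ k)
  simp_rw [h1]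
  rw [integral_comp_eq_sum hU hK (fun k => (k : ℝ) ^ (j + 1) * t ^ k), Finset.sum_div]
  refine HasDerivAt.fun_sum fun k _ => ?_
  refine (((hasDerivAt_pow k t).const_mul ((k : ℝ) ^ j)).const_mul
    (P.real (U ⁻¹' {k}))).congr_deriv ?_
  rcases k with _ | k
  · simp
  · simp only [Nat.add_sub_cancel]
    field_simp; ring

end Bounded

section Pi

variable {m : ℕ} {μ : Measure ℕ} [IsProbabilityMeasure μ] {u : ℕ → ℕ} {K : ℕ}

lemma integral_pow_sum (t : ℝ) :
    ∫ x : Fin m → ℕ, t ^ (∑ j, u (x j)) ∂(Measure.pi fun _ => μ) = (∫ x, t ^ u x ∂μ) ^ m := by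
  simp_rw [← Finset.prod_pow_eq_pow_sum]
  rw [integral_fintype_prod_eq_prod (𝕜 := ℝ) (fun _ : Fin m => fun x => t ^ u x)]
  simp

lemma sum_le_of_le (hK : ∀ x, u x ≤ K) (x : Fin m → ℕ) : ∑ j, u (x j) ≤ m * K := by
  calc ∑ j, u (x j) ≤ ∑ _j : Fin m, K := Finset.sum_le_sum fun j _ => hK _
    _ = m * K := by simp

/-- Obtained by differentiating `integral_pow_sum` in `t`. -/
lemma integral_sum_mul_pow_sum (hK : ∀ x, u x ≤ K) {t : ℝ} (ht : t ≠ 0) :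
    ∫ x : Fin m → ℕ, ((∑ j, u (x j) : ℕ) : ℝ) * t ^ (∑ j, u (x j)) ∂(Measure.pi fun _ => μ) =
      m * (∫ x, t ^ u x ∂μ) ^ (m - 1) * ∫ x, (u x : ℝ) * t ^ u x ∂μ := by
  have h1 := hasDerivAt_integral_pow (P := Measure.pi fun _ : Fin m => μ)
    (U := fun x => ∑ j, u (x j)) (measurable_of_countable _) (sum_le_of_le hK) 0 ht
  have h2 := (hasDerivAt_integral_pow (P := μ) (U := u) (measurable_of_countable _) hK 0 ht).pow m
  simp only [pow_zero, one_mul, zero_add, pow_one, integral_pow_sum] at h1 h2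
  have h3 := h1.unique h2
  field_simp at h3
  linarith

/-- Obtained by differentiating `integral_sum_mul_pow_sum` in `t`. -/
lemma integral_sum_sq_mul_pow_sum (hm : 1 ≤ m) (hK : ∀ x, u x ≤ K) {t : ℝ} (ht : t ≠ 0) :
    ∫ x : Fin m → ℕ, ((∑ j, u (x j) : ℕ) : ℝ) ^ 2 * t ^ (∑ j, u (x j))
        ∂(Measure.pi fun _ => μ) =
      m * (∫ x, t ^ u x ∂μ) ^ (m - 1) * (∫ x, (u x : ℝ) ^ 2 * t ^ u x ∂μ) +
        m * ((m - 1) * (∫ x, t ^ u x ∂μ) ^ (m - 1 - 1)) * (∫ x, (u x : ℝ) * t ^ u x ∂μ) ^ 2 := by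
  have h1 := hasDerivAt_integral_pow (P := Measure.pi fun _ : Fin m => μ)
    (U := fun x => ∑ j, u (x j)) (measurable_of_countable _) (sum_le_of_le hK) 1 ht
  have h2 := (hasDerivAt_integral_pow (P := μ) (U := u) (measurable_of_countable _) hK 0 ht).pow
    (m - 1)
  have h3 := hasDerivAt_integral_pow (P := μ) (U := u) (measurable_of_countable _) hK 1 ht
  simp only [pow_zero, one_mul, zero_add, pow_one] at h1 h2 h3
  have h4 := (h2.const_mul (m : ℝ)).mul h3
  have h5 : (fun t : ℝ => ∫ x : Fin m → ℕ, ((∑ j, u (x j) : ℕ) : ℝ) * t ^ (∑ j, u (x j))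
      ∂(Measure.pi fun _ => μ)) =ᶠ[nhds t] fun t =>
      m * (∫ x, t ^ u x ∂μ) ^ (m - 1) * ∫ x, (u x : ℝ) * t ^ u x ∂μ := by
    filter_upwards [isOpen_ne.mem_nhds ht] with t' ht'
    exact integral_sum_mul_pow_sum hK ht'
  have h6 := (h1.congr_of_eventuallyEq h5.symm).unique h4
  have h7 : ((m - 1 : ℕ) : ℝ) = m - 1 := by push_cast [hm]; ring
  rw [h7] at h6
  field_simp at h6
  simp only [one_add_one_eq_two, Pi.pow_apply] at h6
  linarith

end Pi

/-! ### The weighted moments of truncated laws -/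

/-- Truncation at a level that decreases by one per step commutes with the recursion: a summand
above `T + 1` makes both sides equal to `T`. -/
lemma min_sum_sub_one (m : ℕ) (x : Fin m → ℕ) (T : ℕ) :
    min ((∑ j, x j) - 1) T = min ((∑ j, min (x j) (T + 1)) - 1) T := by
  by_cases h : ∀ j, x j ≤ T + 1
  · have : ∀ j, min (x j) (T + 1) = x j := fun j => min_eq_left (h j)
    simp [this]
  · push Not at h
    obtain ⟨j, hj⟩ := h
    have h1 := Finset.single_le_sum (f := x) (fun _ _ => Nat.zero_le _) (Finset.mem_univ j)
    have h2 := Finset.single_le_sum (f := fun j => min (x j) (T + 1)) (fun _ _ => Nat.zero_le _)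
      (Finset.mem_univ j)
    have h3 : min (x j) (T + 1) = T + 1 := min_eq_right hj.le
    simp only [h3] at h2
    omega

instance isProbabilityMeasure_step (m : ℕ) (μ : Measure ℕ) [IsProbabilityMeasure μ] :
    IsProbabilityMeasure (step m μ) :=
  Measure.isProbabilityMeasure_map (measurable_of_countable _).aemeasurable

lemma integral_step (m : ℕ) (μ : Measure ℕ) (F : ℕ → ℝ) :
    ∫ x, F x ∂(step m μ) = ∫ x : Fin m → ℕ, F ((∑ j, x j) - 1) ∂(Measure.pi fun _ => μ) := by
  rw [step, integral_map (measurable_of_countable _).aemeasurable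
    (measurable_of_countable F).aestronglyMeasurable]

/-- The weighted moments of the truncated variable `X ∧ T`, where `X` has law `μ`. The last one is
`P (X = 0)`, which is `P (X ∧ T = 0)` for `T ≥ 1`. -/
noncomputable def moments (s : ℝ) (T : ℕ) (μ : Measure ℕ) : WeightedMoments where
  G := ∫ x, s ^ min x T ∂μ
  A := ∫ x, ((min x T : ℕ) : ℝ) * s ^ min x T ∂μ
  B := ∫ x, ((min x T : ℕ) : ℝ) ^ 2 * s ^ min x T ∂μ
  q := μ.real {0}

lemma integrable_trunc (μ : Measure ℕ) [IsProbabilityMeasure μ] (T : ℕ) (F : ℕ → ℝ) :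
    Integrable (fun x => F (min x T)) μ :=
  integrable_comp_of_le (measurable_of_countable _) (fun x => min_le_right x T) F

lemma admissible_moments {m : ℕ} (hm : 2 ≤ m) {μ : Measure ℕ} [IsProbabilityMeasure μ] {s c : ℝ}
    (hs : 1 ≤ s) (hsm : s ≤ m) {T : ℕ} (hT : 1 ≤ T) (hq : c ≤ μ.real {0}) :
    (moments s T μ).Admissible m c := by
  have hi := integrable_trunc μ T
  have hs0 : 0 < s := by linarith
  have hq_int : μ.real {0} = ∫ x, (if min x T = 0 then (1 : ℝ) else 0) ∂μ := by
    have : (fun x => if min x T = 0 then (1 : ℝ) else 0) = ({0} : Set ℕ).indicator 1 := by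
      funext x
      have : min x T = 0 ↔ x = 0 := by omega
      simp [Set.indicator, this]
    rw [this, integral_indicator_one (measurableSet_singleton 0)]
  refine ⟨?_, ?_, ?_, ?_, hq, measureReal_le_one, ?_⟩
  · have : ∫ _x : ℕ, (1 : ℝ) ∂μ = 1 := by simp
    rw [← this]
    exact integral_mono (integrable_const _) (hi fun k => s ^ k) fun x => one_le_pow₀ hs
  · exact integral_nonneg fun x => by positivity
  · refine integral_mono (hi fun k => (k : ℝ) * s ^ k) (hi fun k => (k : ℝ) ^ 2 * s ^ k)
      fun x => ?_
    dsimp only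
    gcongr
    exact_mod_cast Nat.le_self_pow two_ne_zero _
  · -- Cauchy-Schwarz, as nonnegativity of a quadratic polynomial
    set G := (moments s T μ).G with hG
    set A := (moments s T μ).A with hA
    set B := (moments s T μ).B with hB
    have hquad : ∀ z : ℝ, 0 ≤ (G - μ.real {0}) * (z * z) + (-2 * A) * z + B := by
      intro z
      have h1 : (G - μ.real {0}) * (z * z) + (-2 * A) * z + B = ∫ x,
          (((s ^ min x T - (if min x T = 0 then (1 : ℝ) else 0)) * (z * z)
            + (-2 * (((min x T : ℕ) : ℝ) * s ^ min x T)) * z)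
            + ((min x T : ℕ) : ℝ) ^ 2 * s ^ min x T) ∂μ := by
        rw [integral_add (hi fun k => (s ^ k - (if k = 0 then (1 : ℝ) else 0)) * (z * z)
            + (-2 * ((k : ℝ) * s ^ k)) * z) (hi fun k => (k : ℝ) ^ 2 * s ^ k),
          integral_add (hi fun k => (s ^ k - (if k = 0 then (1 : ℝ) else 0)) * (z * z))
            (hi fun k => (-2 * ((k : ℝ) * s ^ k)) * z),
          integral_mul_const, integral_mul_const, integral_const_mul,
          integral_sub (hi fun k => s ^ k) (hi fun k => if k = 0 then (1 : ℝ) else 0), ← hq_int]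
        rfl
      rw [h1]
      refine integral_nonneg fun x => ?_
      dsimp only [Pi.zero_apply]
      by_cases h0 : min x T = 0
      · simp [h0]
      · simp only [h0, if_false]
        have : (s ^ min x T - 0) * (z * z) + -2 * (((min x T : ℕ) : ℝ) * s ^ min x T) * z
            + ((min x T : ℕ) : ℝ) ^ 2 * s ^ min x T
            = s ^ min x T * (z - ((min x T : ℕ) : ℝ)) ^ 2 := by ring
        rw [this]
        positivity
    have := discrim_le_zero hquad
    rw [discrim] at this
    show A ^ 2 ≤ B * (G - μ.real {0})
    nlinarith
  · have h1 : (m : ℝ) ^ 8 + (moments s T μ).A / 8 =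
        ∫ x, ((m : ℝ) ^ 8 + ((min x T : ℕ) : ℝ) * s ^ min x T / 8) ∂μ := by
      rw [integral_add (integrable_const _) (hi fun k => (k : ℝ) * s ^ k / 8), integral_div]
      simp [moments]
    rw [h1]
    refine integral_mono (hi fun k => s ^ k)
      (hi fun k => (m : ℝ) ^ 8 + (k : ℝ) * s ^ k / 8) fun x => ?_
    dsimp only
    generalize min x T = k
    have hm1 : (1 : ℝ) ≤ m := by exact_mod_cast (by omega : 1 ≤ m)
    have hp : 0 < s ^ k := by positivity
    rcases le_total k 8 with h | h
    · have h2 : s ^ k ≤ (m : ℝ) ^ 8 :=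
        (pow_le_pow_left₀ hs0.le hsm k).trans (pow_le_pow_right₀ hm1 h)
      have : 0 ≤ (k : ℝ) * s ^ k / 8 := by positivity
      linarith
    · have h2 : (8 : ℝ) ≤ k := by exact_mod_cast h
      have : 0 ≤ (m : ℝ) ^ 8 := by positivity
      nlinarith

lemma sum_min_eq_zero_iff {m : ℕ} (x : Fin m → ℕ) (T : ℕ) :
    ∑ j, min (x j) (T + 1) = 0 ↔ ∀ j, x j = 0 := by
  simp only [Finset.sum_eq_zero_iff, Finset.mem_univ, true_imp_iff]
  exact forall_congr' fun j => by omega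

lemma integral_sum_min_eq_zero (m : ℕ) (μ : Measure ℕ) [IsProbabilityMeasure μ] (T : ℕ) :
    ∫ x : Fin m → ℕ, (if ∑ j, min (x j) (T + 1) = 0 then (1 : ℝ) else 0)
      ∂(Measure.pi fun _ => μ) = μ.real {0} ^ m := by
  have h1 : (fun x : Fin m → ℕ => if ∑ j, min (x j) (T + 1) = 0 then (1 : ℝ) else 0) =
      (Set.univ.pi fun _ : Fin m => ({0} : Set ℕ)).indicator 1 := by
    funext x
    simp only [sum_min_eq_zero_iff, Set.indicator, Set.mem_pi, Set.mem_univ, true_imp_iff,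
      Set.mem_singleton_iff, Pi.one_apply]
  rw [h1, integral_indicator_one (Set.to_countable _).measurableSet, measureReal_def,
    Measure.pi_pi]
  simp [measureReal_def]

/-- The one-step relations for truncated laws. The hypothesis `hT` makes the weights beyond the
truncation level `T` negligible with respect to the moment of base `t > s`. -/
lemma stepRel_moments {m : ℕ} (hm : 2 ≤ m) {μ : Measure ℕ} [IsProbabilityMeasure μ]
    {s t κ ε : ℝ} (hs : 1 < s) (hsm : s ≤ m) (ht : 1 ≤ t) (hκ : 0 ≤ κ) {T : ℕ}
    (hT : ∀ k > T, ((k : ℝ) + 1) ^ 2 * s ^ k ≤ κ * t ^ k)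
    (hε : m * κ * (∫ x, t ^ min x (T + 1) ∂μ) ^ m ≤ ε) :
    StepRel m s ε (moments s (T + 1) μ) (moments s T (step m μ)) := by
  have hs0 : 0 < s := by linarith
  have hm1 : (1 : ℝ) ≤ m := by exact_mod_cast (by omega : 1 ≤ m)
  set P : Measure (Fin m → ℕ) := Measure.pi fun _ => μ
  set S : (Fin m → ℕ) → ℕ := fun x => ∑ j, min (x j) (T + 1) with hS
  have hi : ∀ F : ℕ → ℝ, Integrable (fun x => F (S x)) P :=
    integrable_comp_of_le (measurable_of_countable _)
      (sum_le_of_le (u := fun k => min k (T + 1)) fun x => min_le_right x (T + 1))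
  have htrunc : ∀ F : ℕ → ℝ, ∫ x, F (min x T) ∂(step m μ) = ∫ x, F (min (S x - 1) T) ∂P := by
    intro F
    rw [integral_step m μ fun x => F (min x T)]
    exact integral_congr_ae (ae_of_all _ fun x => congrArg F (min_sum_sub_one m x T))
  set w := moments s (T + 1) μ with hw
  set w' := moments s T (step m μ) with hw'
  have e0 : ∫ x, s ^ S x ∂P = w.G ^ m := integral_pow_sum (u := fun k => min k (T + 1)) s
  have et : ∫ x, t ^ S x ∂P = (∫ x, t ^ min x (T + 1) ∂μ) ^ m :=
    integral_pow_sum (u := fun k => min k (T + 1)) t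
  have e1 : ∫ x, (S x : ℝ) * s ^ S x ∂P = m * w.G ^ (m - 1) * w.A :=
    integral_sum_mul_pow_sum (u := fun k => min k (T + 1)) (fun x => min_le_right x (T + 1))
      hs0.ne'
  have e2 : ∫ x, (S x : ℝ) ^ 2 * s ^ S x ∂P = m * w.G ^ (m - 1) * w.B +
      m * ((m - 1) * w.G ^ (m - 1 - 1)) * w.A ^ 2 :=
    integral_sum_sq_mul_pow_sum (u := fun k => min k (T + 1)) (by omega)
      (fun x => min_le_right x (T + 1)) hs0.ne'
  have eq0 : ∫ x, (if S x = 0 then (1 : ℝ) else 0) ∂P = w.q ^ m := integral_sum_min_eq_zero m μ T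
  have hG0 : 0 < w.G := by
    have h1 : ∫ _x : ℕ, (1 : ℝ) ∂μ ≤ w.G :=
      integral_mono (integrable_const _) (integrable_trunc μ (T + 1) fun k => s ^ k)
        fun x => one_le_pow₀ hs.le
    simp at h1
    linarith
  -- the weight of the truncated range is negligible
  have herr : ∀ k : ℕ, T < k - 1 → ((k - 1 : ℕ) + 1 : ℝ) ^ 2 * s ^ (k - 1) ≤ κ * t ^ k := by
    intro k hk
    refine (hT (k - 1) hk).trans ?_
    have := pow_le_pow_right₀ ht (Nat.sub_le k 1)
    gcongr
  have hpred : ∀ k : ℕ, k ≠ 0 → s ^ (k - 1) = s ^ k / s ∧ ((k - 1 : ℕ) : ℝ) = k - 1 := by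
    intro k hk
    obtain ⟨j, rfl⟩ := Nat.exists_eq_succ_of_ne_zero hk
    constructor
    · simp only [Nat.succ_sub_one]; rw [pow_succ]; field_simp
    · simp
  -- the function whose integral is the drift, and its value without truncation
  let f : ℕ → ℝ := fun k => (s - 1) * ((k : ℝ) * s ^ k) - s ^ k
  have hf : ∀ k, f (k - 1) = m / s * (s - 1) / m * ((k : ℝ) * s ^ k) - s ^ k := by
    intro k
    by_cases hk : k = 0
    · simp [f, hk]
    · obtain ⟨h1, h2⟩ := hpred k hk
      simp only [f, h1, h2]
      have : (m : ℝ) ≠ 0 := by positivity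
      field_simp
      ring
  have hfmono : Monotone f := by
    refine monotone_nat_of_le_succ fun k => ?_
    simp only [f, pow_succ]
    push_cast
    have h1 : 0 ≤ (s - 1) ^ 2 * (k + 1) * s ^ k := by positivity
    nlinarith
  have hdrift : (s - 1) * w'.A - w'.G = ∫ x, f (min (S x - 1) T) ∂P := by
    rw [← htrunc f, integral_sub
      (integrable_trunc (step m μ) T fun k => (s - 1) * ((k : ℝ) * s ^ k))
      (integrable_trunc (step m μ) T fun k => s ^ k), integral_const_mul]
    rfl
  have hdrift0 : ∫ x, f (S x - 1) ∂P
      = m / s * (s - 1) * w.A * w.G ^ (m - 1) - w.G ^ m := by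
    simp_rw [hf]
    rw [integral_sub (hi fun k => m / s * (s - 1) / m * ((k : ℝ) * s ^ k)) (hi fun k => s ^ k),
      integral_const_mul, e0, e1]
    have : (m : ℝ) ≠ 0 := by positivity
    field_simp
  refine ⟨?_, ?_, ?_, ?_⟩
  · have h1 : w'.G = ∫ x, s ^ min (S x - 1) T ∂P := htrunc fun k => s ^ k
    rw [h1, ← e0, ← eq0, ← integral_div, ← integral_const_mul,
      ← integral_add (hi fun k => s ^ k / s)
        (hi fun k => (1 - 1 / s) * if k = 0 then (1 : ℝ) else 0)]
    refine integral_mono (hi fun k => s ^ min (k - 1) T)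
      (hi fun k => s ^ k / s + (1 - 1 / s) * if k = 0 then (1 : ℝ) else 0) fun x => ?_
    dsimp only
    generalize S x = k
    refine (pow_le_pow_right₀ hs.le (min_le_left _ _)).trans ?_
    by_cases hk : k = 0
    · simp [hk]
    · rw [(hpred k hk).1]; simp [hk]
  · rw [hdrift, ← hdrift0]
    exact integral_mono (hi fun k => f (min (k - 1) T)) (hi fun k => f (k - 1))
      fun x => hfmono (min_le_left _ _)
  · have h1 : ∫ x, f (S x - 1) ∂P - m * κ * ∫ x, t ^ S x ∂P ≤ (s - 1) * w'.A - w'.G := by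
      rw [hdrift, ← integral_const_mul,
        ← integral_sub (hi fun k => f (k - 1)) (hi fun k => m * κ * t ^ k)]
      refine integral_mono (hi fun k => f (k - 1) - m * κ * t ^ k)
        (hi fun k => f (min (k - 1) T)) fun x => ?_
      dsimp only
      generalize S x = k
      rcases le_or_gt (k - 1) T with h | h
      · rw [min_eq_left h]
        have : 0 ≤ m * κ * t ^ k := by positivity
        linarith
      · have h2 := herr k h
        have h3 : -1 ≤ f (min (k - 1) T) := by
          have := hfmono (Nat.zero_le (min (k - 1) T))
          simpa [f] using this
        have h4 : f (k - 1) + 1 ≤ m * (((k - 1 : ℕ) + 1 : ℝ) ^ 2 * s ^ (k - 1)) := by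
          simp only [f]
          generalize k - 1 = j
          have h5 : 1 ≤ s ^ j := one_le_pow₀ hs.le
          have h6 : (s - 1) * ((j : ℝ) * s ^ j) ≤ m * (((j : ℝ) + 1) ^ 2 * s ^ j) := by
            have : (j : ℝ) ≤ ((j : ℝ) + 1) ^ 2 := by nlinarith [Nat.cast_nonneg (α := ℝ) j]
            gcongr
            linarith
          linarith
        have h5 := mul_le_mul_of_nonneg_left h2 (by linarith : (0 : ℝ) ≤ m)
        linarith
    rw [hdrift0, et] at h1
    linarith
  · have hsecond : w'.A + w'.B = ∫ x, (((min (S x - 1) T : ℕ) : ℝ) * s ^ min (S x - 1) T +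
        ((min (S x - 1) T : ℕ) : ℝ) ^ 2 * s ^ min (S x - 1) T) ∂P := by
      rw [← htrunc fun k => (k : ℝ) * s ^ k + (k : ℝ) ^ 2 * s ^ k, integral_add
        (integrable_trunc (step m μ) T fun k => (k : ℝ) * s ^ k)
        (integrable_trunc (step m μ) T fun k => (k : ℝ) ^ 2 * s ^ k)]
      rfl
    have h0 : ∫ x, ((S x : ℝ) ^ 2 * s ^ S x - (S x : ℝ) * s ^ S x) / s ∂P =
        m / s * w.G ^ (m - 1) * (w.B - w.A + (m - 1) * w.A ^ 2 / w.G) := by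
      rw [integral_div, integral_sub (hi fun k => (k : ℝ) ^ 2 * s ^ k)
        (hi fun k => (k : ℝ) * s ^ k), e1, e2]
      have hpow : w.G ^ (m - 1) = w.G ^ (m - 1 - 1) * w.G := by
        rw [← pow_succ, Nat.sub_add_cancel (by omega)]
      rw [hpow]
      field_simp
      ring
    have h1 : ∫ x, ((S x : ℝ) ^ 2 * s ^ S x - (S x : ℝ) * s ^ S x) / s ∂P -
        κ * ∫ x, t ^ S x ∂P ≤ w'.A + w'.B := by
      rw [hsecond, ← integral_const_mul,
        ← integral_sub (hi fun k => ((k : ℝ) ^ 2 * s ^ k - (k : ℝ) * s ^ k) / s)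
          (hi fun k => κ * t ^ k)]
      refine integral_mono (hi fun k => ((k : ℝ) ^ 2 * s ^ k - (k : ℝ) * s ^ k) / s - κ * t ^ k)
        (hi fun k => ((min (k - 1) T : ℕ) : ℝ) * s ^ min (k - 1) T +
          ((min (k - 1) T : ℕ) : ℝ) ^ 2 * s ^ min (k - 1) T) fun x => ?_
      dsimp only
      generalize S x = k
      have hz : ((k : ℝ) ^ 2 * s ^ k - (k : ℝ) * s ^ k) / s =
          ((k - 1 : ℕ) : ℝ) * s ^ (k - 1) + ((k - 1 : ℕ) : ℝ) ^ 2 * s ^ (k - 1) := by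
        by_cases hk : k = 0
        · simp [hk]
        · obtain ⟨h1, h2⟩ := hpred k hk
          rw [h1, h2]; ring
      rw [hz]
      have hnn : 0 ≤ κ * t ^ k := by positivity
      rcases le_or_gt (k - 1) T with h | h
      · rw [min_eq_left h]
        linarith
      · have h2 := herr k h
        have h3 : 0 ≤ ((min (k - 1) T : ℕ) : ℝ) * s ^ min (k - 1) T +
          ((min (k - 1) T : ℕ) : ℝ) ^ 2 * s ^ min (k - 1) T := by positivity
        have h4 : 0 ≤ (((k - 1 : ℕ) : ℝ) + 1) * s ^ (k - 1) := by positivity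
        nlinarith
    rw [h0, et] at h1
    have h2 : κ * (∫ x, t ^ min x (T + 1) ∂μ) ^ m ≤ m * κ * (∫ x, t ^ min x (T + 1) ∂μ) ^ m := by
      have : 0 ≤ ∫ x, t ^ min x (T + 1) ∂μ := integral_nonneg fun x => by positivity
      gcongr
      exact le_mul_of_one_le_left hκ hm1
    linarith

/-- Tails of order `R ^ (-k)` up to the truncation level bound the truncated moment of base `t < R`,
uniformly in the truncation level. -/
lemma integral_pow_min_le {μ : Measure ℕ} [IsProbabilityMeasure μ] {t R C : ℝ} (ht : 1 ≤ t)
    (htR : t < R) (hC : 0 ≤ C) {T : ℕ} (htail : ∀ k ≤ T, μ.real (Set.Ici k) ≤ C / R ^ k) :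
    ∫ x, t ^ min x T ∂μ ≤ 1 + C / (1 - t / R) := by
  have ht0 : 0 < t := by linarith
  have hR : 0 < R := by linarith
  have hρ : t / R < 1 := (div_lt_one hR).mpr htR
  have hpt : ∀ x : ℕ, t ^ min x T ≤
      1 + ∑ k ∈ Finset.range (T + 1), t ^ k * (Set.Ici k).indicator (fun _ => (1 : ℝ)) x := by
    intro x
    have h1 := Finset.single_le_sum (s := Finset.range (T + 1))
      (f := fun k => t ^ k * (Set.Ici k).indicator (fun _ => (1 : ℝ)) x)
      (fun k _ => mul_nonneg (by positivity) (Set.indicator_nonneg (fun _ _ => zero_le_one) _))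
      (Finset.mem_range.mpr (Nat.lt_succ_of_le (min_le_right x T)))
    have h2 : (Set.Ici (min x T)).indicator (fun _ => (1 : ℝ)) x = 1 :=
      Set.indicator_of_mem (Set.mem_Ici.mpr (min_le_left x T)) _
    simp only [h2, mul_one] at h1
    linarith
  have hint : ∀ k ∈ Finset.range (T + 1), Integrable
      (fun x => t ^ k * (Set.Ici k).indicator (fun _ => (1 : ℝ)) x) μ := fun k _ =>
    ((integrable_const _).indicator (Set.to_countable _).measurableSet).const_mul _
  calc ∫ x, t ^ min x T ∂μ
      ≤ ∫ x, (1 + ∑ k ∈ Finset.range (T + 1),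
          t ^ k * (Set.Ici k).indicator (fun _ => (1 : ℝ)) x) ∂μ :=
        integral_mono (integrable_trunc μ T fun k => t ^ k)
          ((integrable_const _).add (integrable_finsetSum _ hint)) hpt
    _ = 1 + ∑ k ∈ Finset.range (T + 1), t ^ k * μ.real (Set.Ici k) := by
        rw [integral_add (integrable_const _) (integrable_finsetSum _ hint),
          integral_finsetSum _ hint]
        simp_rw [integral_const_mul, integral_indicator_const _ (Set.to_countable _).measurableSet]
        simp
    _ ≤ 1 + ∑ k ∈ Finset.range (T + 1), C * (t / R) ^ k := by
        refine add_le_add_right (Finset.sum_le_sum fun k hk => ?_) 1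
        have := htail k (Nat.lt_succ_iff.mp (Finset.mem_range.mp hk))
        calc t ^ k * μ.real (Set.Ici k) ≤ t ^ k * (C / R ^ k) := by gcongr
          _ = C * (t / R) ^ k := by rw [div_pow]; ring
    _ ≤ 1 + C / (1 - t / R) := by
        rw [← Finset.mul_sum, div_eq_mul_inv C]
        refine add_le_add_right (mul_le_mul_of_nonneg_left ?_ hC) 1
        have h1 : 0 ≤ t / R := by positivity
        have := Summable.sum_le_tsum (Finset.range (T + 1)) (fun k _ => pow_nonneg h1 k)
          (summable_geometric_of_lt_one h1 hρ)
        rwa [tsum_geometric_of_lt_one h1 hρ] at this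

/-! ### The test for supercriticality -/

lemma isProbabilityMeasure_law {m : ℕ} {ν : Measure ℕ} [IsProbabilityMeasure ν] {p : ℝ}
    (hp : p ∈ Set.Ioo (0 : ℝ) 1) (n : ℕ) : IsProbabilityMeasure (law m ν p n) := by
  induction n with
  | zero =>
    refine ⟨?_⟩
    simp only [law, initialLaw, Measure.add_apply, Measure.smul_apply, measure_univ, smul_eq_mul,
      mul_one]
    rw [← ENNReal.ofReal_add (by linarith [hp.2]) hp.1.le]
    simp
  | succ n ih => exact isProbabilityMeasure_step m _

/-- The expectation `E (2 ^ (-X))`, where `X` has law `μ`. -/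
noncomputable def halfMoment (μ : Measure ℕ) : ℝ := ∫ x, (1 / 2 : ℝ) ^ x ∂μ

section Half

variable {m : ℕ} {μ : Measure ℕ}

lemma integrable_half_pow {Ω : Type*} [MeasurableSpace Ω] {P : Measure Ω} [IsFiniteMeasure P]
    {U : Ω → ℕ} (hU : Measurable U) : Integrable (fun ω => (1 / 2 : ℝ) ^ U ω) P := by
  refine Integrable.of_bound (C := 1)
    ((measurable_of_countable fun k : ℕ => (1 / 2 : ℝ) ^ k).comp hU).aestronglyMeasurable
    (ae_of_all _ fun ω => ?_)
  rw [Real.norm_of_nonneg (by positivity)]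
  exact pow_le_one₀ (by norm_num) (by norm_num)

lemma halfMoment_nonneg : 0 ≤ halfMoment μ := integral_nonneg fun x => by positivity

variable [IsProbabilityMeasure μ]

lemma halfMoment_step_le : halfMoment (step m μ) ≤ 2 * halfMoment μ ^ m := by
  have h1 : ∫ x : Fin m → ℕ, (1 / 2 : ℝ) ^ (∑ j, x j) ∂(Measure.pi fun _ => μ)
      = halfMoment μ ^ m := integral_pow_sum (u := id) (1 / 2)
  rw [halfMoment, integral_step, ← h1, ← integral_const_mul]
  refine integral_mono (integrable_half_pow (measurable_of_countable _))
    ((integrable_half_pow (measurable_of_countable _)).const_mul 2) fun x => ?_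
  dsimp only
  generalize ∑ j, x j = k
  rcases k with _ | k
  · norm_num
  · rw [Nat.add_sub_cancel, pow_succ]; linarith

lemma measureReal_zero_le_halfMoment : μ.real {0} ≤ halfMoment μ := by
  rw [← integral_indicator_one (measurableSet_singleton 0), halfMoment]
  refine integral_mono ((integrable_const 1).indicator (measurableSet_singleton 0))
    (integrable_half_pow measurable_id) fun x => ?_
  by_cases hx : x = 0
  · simp [hx]
  · simp [hx]

lemma halfMoment_le (μ : Measure ℕ) [IsProbabilityMeasure μ] :
    halfMoment μ ≤ μ.real {0} + μ.real {1} / 2 + (1 - μ.real {0} - μ.real {1}) / 4 := by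
  have h1 : μ.real {0} + μ.real {1} / 2 + (1 - μ.real {0} - μ.real {1}) / 4 =
      ∫ x, (3 / 4 * ({0} : Set ℕ).indicator 1 x + 1 / 4 * ({1} : Set ℕ).indicator 1 x + 1 / 4)
        ∂μ := by
    rw [integral_add, integral_add, integral_const_mul, integral_const_mul,
      integral_indicator_one (measurableSet_singleton 0),
      integral_indicator_one (measurableSet_singleton 1)]
    · simp; ring
    · exact ((integrable_const 1).indicator (measurableSet_singleton 0)).const_mul _
    · exact ((integrable_const 1).indicator (measurableSet_singleton 1)).const_mul _
    · exact (((integrable_const 1).indicator (measurableSet_singleton 0)).const_mul _).add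
        (((integrable_const 1).indicator (measurableSet_singleton 1)).const_mul _)
    · exact integrable_const _
  rw [h1, halfMoment]
  refine integral_mono (integrable_half_pow measurable_id) ?_ fun x => ?_
  · exact (((((integrable_const 1).indicator (measurableSet_singleton 0)).const_mul _).add
        (((integrable_const 1).indicator (measurableSet_singleton 1)).const_mul _)).add
        (integrable_const _))
  · dsimp only
    rcases x with _ | _ | x
    · norm_num [Set.indicator]
    · norm_num [Set.indicator]
    · have : (1 / 2 : ℝ) ^ x ≤ 1 := pow_le_one₀ (by norm_num) (by norm_num)
      rw [pow_add, pow_add]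
      simp [Set.indicator]
      rw [one_div, inv_pow] at this
      linarith

lemma halfMoment_le_Iio_two (μ : Measure ℕ) [IsProbabilityMeasure μ] :
    halfMoment μ ≤ μ.real (Set.Iio 2) + 1 / 4 := by
  have h1 : μ.real (Set.Iio 2) = μ.real {0} + μ.real {1} := by
    rw [← measureReal_union (by simp) (measurableSet_singleton 1)]
    congr 1
    ext x
    simp only [Set.mem_Iio, Set.mem_union, Set.mem_singleton_iff]
    omega
  have h2 := halfMoment_le μ
  have h3 : (0 : ℝ) ≤ μ.real {0} := measureReal_nonneg
  have h4 : (0 : ℝ) ≤ μ.real {1} := measureReal_nonneg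
  linarith

/-- If the sum minus one is below `l`, each summand is below `l + 1`. -/
lemma measureReal_step_Iio_le (l : ℕ) :
    (step m μ).real (Set.Iio l) ≤ μ.real (Set.Iio (l + 1)) ^ m := by
  have h1 : (Measure.pi fun _ : Fin m => μ).real (Set.univ.pi fun _ => Set.Iio (l + 1)) =
      μ.real (Set.Iio (l + 1)) ^ m := by
    rw [measureReal_def, Measure.pi_pi]; simp [measureReal_def]
  rw [← h1, step, map_measureReal_apply (measurable_of_countable _)
    (Set.to_countable _).measurableSet]
  refine measureReal_mono ?_
  intro x hx
  simp only [Set.mem_preimage, Set.mem_Iio, Set.mem_pi, Set.mem_univ, true_imp_iff] at hx ⊢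
  intro j
  have := Finset.single_le_sum (f := x) (fun _ _ => Nat.zero_le _) (Finset.mem_univ j)
  omega

/-- For `m = 2` the value `0` arises from the pairs `(0, 0)`, `(0, 1)` and `(1, 0)`. -/
lemma le_measureReal_step_two_zero :
    μ.real {0} ^ 2 + 2 * (μ.real {0} * μ.real {1}) ≤ (step 2 μ).real {0} := by
  have hpi : ∀ a b : ℕ,
      (Measure.pi fun _ : Fin 2 => μ).real {![a, b]} = μ.real {a} * μ.real {b} := by
    intro a b
    rw [measureReal_def, Measure.pi_singleton]
    simp [measureReal_def]
  have h1 : μ.real {0} ^ 2 + 2 * (μ.real {0} * μ.real {1}) =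
      (Measure.pi fun _ : Fin 2 => μ).real (({![0, 0]} ∪ {![0, 1]}) ∪ {![1, 0]}) := by
    rw [measureReal_union _ (measurableSet_singleton _),
      measureReal_union _ (measurableSet_singleton _), hpi, hpi, hpi]
    · ring
    · simp
    · simp
  rw [h1, step, map_measureReal_apply (measurable_of_countable _)
    (Set.to_countable _).measurableSet]
  refine measureReal_mono ?_
  intro x hx
  simp only [Set.mem_union, Set.mem_singleton_iff] at hx
  rcases hx with (rfl | rfl) | rfl <;> simp

end Half

/-! ### Tails and mass at zero in the absence of supercriticality -/

section Dichotomy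

variable {m : ℕ} {μ : ℕ → Measure ℕ} [∀ n, IsProbabilityMeasure (μ n)] {b e : ℝ} {M : ℕ}

lemma mul_halfMoment_le_pow (hm : 1 ≤ m) (hμ : ∀ n, μ (n + 1) = step m (μ n)) (hb : 0 ≤ b)
    (hb2 : b ^ (m - 1) = 2) (i k : ℕ) :
    b * halfMoment (μ (i + k)) ≤ (b * halfMoment (μ i)) ^ m ^ k := by
  induction k with
  | zero => simp
  | succ k ih =>
    have h0 : 0 ≤ b * halfMoment (μ (i + k)) := mul_nonneg hb halfMoment_nonneg
    calc b * halfMoment (μ (i + (k + 1)))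
        ≤ b * (2 * halfMoment (μ (i + k)) ^ m) := by
          rw [← add_assoc, hμ]
          exact mul_le_mul_of_nonneg_left halfMoment_step_le hb
      _ = (b * halfMoment (μ (i + k))) ^ m := by
          rw [mul_pow, ← hb2, ← mul_assoc, ← pow_succ', Nat.sub_add_cancel hm]
      _ ≤ ((b * halfMoment (μ i)) ^ m ^ k) ^ m := pow_le_pow_left₀ h0 ih m
      _ = _ := by rw [← pow_mul, ← pow_succ]

lemma measureReal_zero_le_exp (hm : 1 ≤ m) (hμ : ∀ n, μ (n + 1) = step m (μ n)) (hb : 1 ≤ b)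
    (hb2 : b ^ (m - 1) = 2) {n : ℕ} (hMn : M ≤ n)
    (hM : b * halfMoment (μ M) ≤ Real.exp (-e)) :
    (μ n).real {0} ≤ Real.exp (-e * (m : ℝ) ^ (n - M)) := by
  have h1 := mul_halfMoment_le_pow hm hμ (by linarith) hb2 M (n - M)
  rw [Nat.add_sub_cancel' hMn] at h1
  have h0 : 0 ≤ b * halfMoment (μ M) := mul_nonneg (by linarith) halfMoment_nonneg
  calc (μ n).real {0} ≤ halfMoment (μ n) := measureReal_zero_le_halfMoment
    _ ≤ b * halfMoment (μ n) := le_mul_of_one_le_left halfMoment_nonneg hb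
    _ ≤ (b * halfMoment (μ M)) ^ m ^ (n - M) := h1
    _ ≤ Real.exp (-e) ^ m ^ (n - M) := pow_le_pow_left₀ h0 hM _
    _ = _ := by rw [← Real.exp_nat_mul]; congr 1; push_cast; ring

lemma one_sub_lt_mul_halfMoment (hm : 1 ≤ m) (hμ : ∀ n, μ (n + 1) = step m (μ n)) (hb : 0 ≤ b)
    (hb2 : b ^ (m - 1) = 2) (he : 0 ≤ e) (hM : Real.exp (-e) < b * halfMoment (μ M)) {i : ℕ}
    (hi : i ≤ M) : 1 - e < b * halfMoment (μ i) := by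
  have h1 : 1 - e ≤ Real.exp (-e) := by linarith [Real.add_one_le_exp (-e)]
  refine h1.trans_lt (lt_of_not_ge fun h => ?_)
  have h2 := mul_halfMoment_le_pow hm hμ hb hb2 i (M - i)
  rw [Nat.add_sub_cancel' hi] at h2
  have h0 : 0 ≤ b * halfMoment (μ i) := mul_nonneg hb halfMoment_nonneg
  have h3 : b * halfMoment (μ i) ≤ 1 := h.trans (by rw [Real.exp_le_one_iff]; linarith)
  have h4 : (b * halfMoment (μ i)) ^ m ^ (M - i) ≤ b * halfMoment (μ i) :=
    pow_le_of_le_one h0 h3 (by positivity)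
  linarith

lemma measureReal_Iio_le_pow (hμ : ∀ n, μ (n + 1) = step m (μ n)) (i k l : ℕ) :
    (μ (i + k)).real (Set.Iio l) ≤ (μ i).real (Set.Iio (l + k)) ^ m ^ k := by
  induction k generalizing l with
  | zero => simp
  | succ k ih =>
    calc (μ (i + (k + 1))).real (Set.Iio l) ≤ (μ (i + k)).real (Set.Iio (l + 1)) ^ m := by
          rw [← add_assoc, hμ]; exact measureReal_step_Iio_le l
      _ ≤ ((μ i).real (Set.Iio (l + 1 + k)) ^ m ^ k) ^ m :=
          pow_le_pow_left₀ measureReal_nonneg (ih (l + 1)) m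
      _ = _ := by rw [← pow_mul, ← pow_succ, add_assoc l, add_comm 1 k]

/-- If `P (Xᵢ ≥ k)` were larger, some of the `m ^ (k - 2)` independent copies of `Xᵢ` that enter
`X_{i + k - 2}` would be at least `k` with high probability,
and `X_{i + k - 2}` would be at least `2`. -/
lemma measureReal_Ici_le (hm : 2 ≤ m) (hμ : ∀ n, μ (n + 1) = step m (μ n))
    (hF : ∀ i ≤ M, 19 / 40 ≤ halfMoment (μ i)) {i k : ℕ} (hi : i + k ≤ M) :
    (μ i).real (Set.Ici k) ≤ 3 * (m : ℝ) ^ 2 / (m : ℝ) ^ k := by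
  have hm1 : (1 : ℝ) ≤ m := by exact_mod_cast (by omega : 1 ≤ m)
  rcases lt_or_ge k 2 with hk | hk
  · refine measureReal_le_one.trans ?_
    rw [one_le_div (by positivity)]
    have : (m : ℝ) ^ k ≤ (m : ℝ) ^ 2 := pow_le_pow_right₀ hm1 hk.le
    have : 0 ≤ (m : ℝ) ^ 2 := by positivity
    linarith
  · obtain ⟨j, rfl⟩ := Nat.exists_eq_add_of_le' hk
    have h1 := hF (i + j) (by omega)
    have h2 := halfMoment_le_Iio_two (μ (i + j))
    have h3 := measureReal_Iio_le_pow hμ i j 2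
    set t := (μ i).real (Set.Ici (j + 2)) with ht
    have h4 : (μ i).real (Set.Iio (2 + j)) = 1 - t := by
      have := measureReal_compl (μ := μ i) (Set.to_countable (Set.Ici (j + 2))).measurableSet
      rw [Set.compl_Ici, probReal_univ] at this
      rw [add_comm 2 j, this]
    have ht1 : t ≤ 1 := measureReal_le_one
    rw [h4] at h3
    have h5 : (1 - t) ^ m ^ j ≤ Real.exp (-(t * (m : ℝ) ^ j)) := by
      calc (1 - t) ^ m ^ j ≤ Real.exp (-t) ^ m ^ j :=
            pow_le_pow_left₀ (by linarith) (by linarith [Real.add_one_le_exp (-t)]) _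
        _ = _ := by rw [← Real.exp_nat_mul]; congr 1; push_cast; ring
    have h6 : Real.exp (-3) < 9 / 40 := by
      have h7 : Real.exp 1 ^ 3 = Real.exp 3 := by rw [Real.exp_one_pow]; norm_num
      have h8 : (2 : ℝ) < Real.exp 1 := lt_trans (by norm_num) Real.exp_one_gt_d9
      have h9 : (2 : ℝ) ^ 3 < Real.exp 1 ^ 3 := pow_lt_pow_left₀ h8 (by norm_num) (by norm_num)
      rw [h7] at h9
      rw [Real.exp_neg, inv_lt_comm₀ (by positivity) (by norm_num)]
      refine lt_trans ?_ h9
      norm_num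
    have h7 : t * (m : ℝ) ^ j ≤ 3 := by
      by_contra! h
      have : Real.exp (-(t * (m : ℝ) ^ j)) ≤ Real.exp (-3) := by
        rw [Real.exp_le_exp]; linarith
      linarith
    have hmj : 0 < (m : ℝ) ^ j := by positivity
    have hm0 : (m : ℝ) ^ 2 ≠ 0 := by positivity
    calc t ≤ 3 / (m : ℝ) ^ j := by rwa [le_div_iff₀ hmj]
      _ = _ := by rw [pow_add]; field_simp

lemma measureReal_zero_add_one_le (μ : Measure ℕ) [IsProbabilityMeasure μ] :
    μ.real {0} + μ.real {1} ≤ 1 := by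
  rw [← measureReal_union (by simp) (measurableSet_singleton 1)]
  exact measureReal_le_one

/-- For `m ≥ 3` the lower bound on `E (2 ^ (-Xᵢ))` suffices. For `m = 2` it only shows that `Xᵢ` is
close to `1` when `P (Xᵢ = 0)` is small, and then `P (Xᵢ = 0)` increases with `i`. -/
lemma le_measureReal_zero (hm : 2 ≤ m) (hμ : ∀ n, μ (n + 1) = step m (μ n)) (hb : 1 ≤ b)
    (hb2 : b ^ (m - 1) = 2) (he : e ≤ 1 / 20)
    (hF : ∀ i ≤ M, 1 - e < b * halfMoment (μ i)) {q₀ : ℝ} (hq₀ : q₀ ≤ 1 / 100)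
    (h0 : m = 2 → q₀ ≤ (μ 0).real {0}) {i : ℕ} (hi : i ≤ M) : q₀ ≤ (μ i).real {0} := by
  rcases hm.eq_or_lt with rfl | hm3
  · have hb' : b = 2 := by simpa using hb2
    subst hb'
    induction i with
    | zero => exact h0 rfl
    | succ i ih =>
      have h1 := ih (by omega)
      have h2 := hF i (by omega)
      have h3 := halfMoment_le (μ i)
      have h4 := le_measureReal_step_two_zero (μ := μ i)
      rw [← hμ] at h4
      have h5 : (0 : ℝ) ≤ (μ i).real {0} := measureReal_nonneg
      have h6 : (0 : ℝ) ≤ (μ i).real {1} := measureReal_nonneg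
      set q := (μ i).real {0}
      rcases le_total q (1 / 10) with h | h
      · have h7 : 1 / 2 ≤ (μ i).real {1} := by linarith
        nlinarith
      · nlinarith
  · have h1 := hF i hi
    have h2 := halfMoment_le (μ i)
    have h3 := measureReal_zero_add_one_le (μ i)
    have h4 : b ^ 2 ≤ 2 := hb2 ▸ pow_le_pow_right₀ hb (by omega)
    have h5 : b ≤ 3 / 2 := by nlinarith
    have h6 : b * halfMoment (μ i) ≤ 3 / 2 * halfMoment (μ i) :=
      mul_le_mul_of_nonneg_right h5 halfMoment_nonneg
    linarith

end Dichotomy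

/-- The initial mass at `0` cannot be small for `m = 2`: `E (2 ^ (-X₀))` is well below `1 / 2` when
`p` is near `1`, since `X₀*` exceeds `1` with probability `c`. -/
lemma le_initialLaw_zero {ν : Measure ℕ} [IsProbabilityMeasure ν] (hν : ν {0} = 0) {p c e : ℝ}
    (hp : p ∈ Set.Ioo (0 : ℝ) 1) (hc : ν.real (Set.Ici 2) = c)
    [IsProbabilityMeasure (initialLaw ν p)] (he : e ≤ c / 4)
    (hF : 1 - e < 2 * halfMoment (initialLaw ν p)) : c / 6 ≤ (initialLaw ν p).real {0} := by
  have hp0 := hp.1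
  have hp1 := hp.2
  have hreal : ∀ k : ℕ, (initialLaw ν p).real {k} =
      (1 - p) * (Measure.dirac 0 : Measure ℕ).real {k} + p * ν.real {k} := by
    intro k
    rw [initialLaw, measureReal_add_apply
        (ENNReal.mul_ne_top ENNReal.ofReal_ne_top (measure_ne_top _ _))
        (ENNReal.mul_ne_top ENNReal.ofReal_ne_top (measure_ne_top _ _)),
      measureReal_ennreal_smul_apply, measureReal_ennreal_smul_apply,
      ENNReal.toReal_ofReal (by linarith), ENNReal.toReal_ofReal hp0.le]
  have h0 : (initialLaw ν p).real {0} = 1 - p := by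
    rw [hreal]; simp [measureReal_def, hν]
  have hν1 : ν.real {1} = 1 - c := by
    have h1 : ν.real (Set.Ici 2)ᶜ = 1 - c := by
      rw [measureReal_compl (Set.to_countable _).measurableSet, hc, probReal_univ]
    have h2 : (Set.Ici 2)ᶜ = ({0} ∪ {1} : Set ℕ) := by
      ext x
      simp only [Set.mem_compl_iff, Set.mem_Ici, Set.mem_union, Set.mem_singleton_iff]
      omega
    rw [h2, measureReal_union (by simp) (measurableSet_singleton 1)] at h1
    simpa [measureReal_def, hν] using h1
  have h1 : (initialLaw ν p).real {1} = p * (1 - c) := by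
    rw [hreal, hν1]; simp [measureReal_def]
  have h2 := halfMoment_le (initialLaw ν p)
  have hc1 : c ≤ 1 := hc ▸ measureReal_le_one
  have hc0 : 0 ≤ c := hc ▸ measureReal_nonneg
  rw [h0, h1] at h2
  rw [h0]
  nlinarith

/-! ### The product along the recursion -/

lemma tendsto_sq_mul_pow {s t : ℝ} (hs : 0 < s) (hst : s < t) :
    Filter.Tendsto (fun k : ℕ => ((k : ℝ) + 1) ^ 2 * s ^ k / t ^ k) Filter.atTop (nhds 0) := by
  have ht : 0 < t := hs.trans hst
  have hr : |s / t| < 1 := by rw [abs_of_pos (by positivity), div_lt_one ht]; exact hst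
  have h := (tendsto_pow_const_mul_const_pow_of_abs_lt_one 2 hr).comp
    (Filter.tendsto_add_atTop_nat 1)
  have h2 := h.mul_const (s / t)⁻¹
  rw [zero_mul] at h2
  refine h2.congr fun k => ?_
  have : s / t ≠ 0 := by positivity
  simp only [Function.comp_apply, pow_succ (s / t)]
  push_cast
  rw [div_pow]
  field_simp

lemma exists_pow_bounds {s t κ : ℝ} (hs : 0 < s) (hst : s < t) (hκ : 0 < κ) :
    ∃ (T : ℕ) (B : ℝ), 0 < B ∧ (∀ k > T, ((k : ℝ) + 1) ^ 2 * s ^ k ≤ κ * t ^ k) ∧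
      ∀ k : ℕ, ((k : ℝ) + 1) ^ 2 * s ^ k ≤ B * t ^ k := by
  have ht : 0 < t := hs.trans hst
  have h := tendsto_sq_mul_pow hs hst
  obtain ⟨T, hT⟩ := Filter.eventually_atTop.mp (h.eventually_le_const hκ)
  obtain ⟨B, hB⟩ := h.bddAbove_range
  refine ⟨T, max 1 B, by positivity, fun k hk => ?_, fun k => ?_⟩
  · have := hT k hk.le
    rwa [div_le_iff₀ (by positivity)] at this
  · have h1 : ((k : ℝ) + 1) ^ 2 * s ^ k / t ^ k ≤ B := hB ⟨k, rfl⟩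
    rw [← div_le_iff₀ (by positivity)]
    exact h1.trans (le_max_right _ _)

/-- Tail bounds up to the horizon `M` and a lower bound on the mass at `0` imply the bound on the
product. -/
theorem exists_prod_le {m : ℕ} (hm : 2 ≤ m) {q₀ δ : ℝ} (hq₀ : 0 < q₀) (hδ : 0 < δ) :
    ∃ C : ℝ, 0 < C ∧ ∀ (μ : ℕ → Measure ℕ) (M : ℕ), 1 ≤ M → (∀ n, IsProbabilityMeasure (μ n)) →
      (∀ n, μ (n + 1) = step m (μ n)) → (∀ i ≤ M, q₀ ≤ (μ i).real {0}) →
      (∀ i k, i + k ≤ M → (μ i).real (Set.Ici k) ≤ 3 * (m : ℝ) ^ 2 / (m : ℝ) ^ k) →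
      ∏ i ∈ Finset.range M,
          (∫ x : ℕ, (m : ℝ) ^ ((1 - δ) * ((min x (M - i) : ℕ) : ℝ)) ∂(μ i)) ^ (m - 1)
        ≤ C * (m : ℝ) ^ (2 * δ * (M : ℝ)) := by
  have hm' : (2 : ℝ) ≤ m := by exact_mod_cast hm
  have hm0 : (0 : ℝ) < m := by linarith
  have hlog : 0 < Real.log m := Real.log_pos (by linarith)
  -- the rate `3 * θ` does not exceed that of `m ^ (2 * δ * M)`
  obtain ⟨θ, hθ, hθ1, hθ2⟩ : ∃ θ : ℝ, 0 < θ ∧ θ ≤ 1 / 2 ∧ 3 * θ ≤ 2 * δ * Real.log m :=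
    ⟨min (1 / 2) (2 * δ * Real.log m / 3), by positivity, min_le_left _ _, by
      linarith [min_le_right (1 / 2) (2 * δ * Real.log m / 3)]⟩
  obtain ⟨K, η, γ, Λ, τ, hτ, htun⟩ := exists_tuning hm hq₀ hθ hθ1
  have hmδ : 1 < (m : ℝ) ^ δ := Real.one_lt_rpow (by linarith) hδ
  -- `s = m / (1 + σ)` is close enough to `m` for the tuning and at least `m ^ (1 - δ)`
  obtain ⟨σ, hσ, hσ1, hσ2, hσ3⟩ : ∃ σ : ℝ, 0 < σ ∧ σ ≤ τ ∧ σ ≤ 1 / 2 ∧ σ ≤ (m : ℝ) ^ δ - 1 :=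
    ⟨min τ (min (1 / 2) ((m : ℝ) ^ δ - 1)),
      lt_min hτ (lt_min (by norm_num) (by linarith)), min_le_left _ _,
      (min_le_right _ _).trans (min_le_left _ _), (min_le_right _ _).trans (min_le_right _ _)⟩
  obtain ⟨s, hs⟩ : ∃ s : ℝ, s = m / (1 + σ) := ⟨_, rfl⟩
  have hs43 : 4 / 3 ≤ s := by rw [hs, le_div_iff₀ (by linarith)]; linarith
  have hs0 : 0 < s := by linarith
  have hsm : s < m := by rw [hs, div_lt_iff₀ (by linarith)]; nlinarith
  have hms : (m : ℝ) / s - 1 = σ := by rw [hs]; field_simp; ring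
  have hsδ : (m : ℝ) ^ (1 - δ) ≤ s := by
    rw [hs, Real.rpow_sub hm0, Real.rpow_one]
    gcongr
    linarith
  obtain ⟨ε, hε, hT⟩ := htun s hs43 hsm (hms ▸ hσ1)
  obtain ⟨t, ht⟩ : ∃ t : ℝ, t = (s + m) / 2 := ⟨_, rfl⟩
  have hst : s < t := by linarith
  have htm : t < m := by linarith
  obtain ⟨E, hE⟩ : ∃ E : ℝ, E = 1 + 3 * (m : ℝ) ^ 2 / (1 - t / m) := ⟨_, rfl⟩
  have hEpos : 0 < E := by
    have : t / m < 1 := (div_lt_one hm0).mpr htm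
    have : 0 < 1 - t / m := by linarith
    rw [hE]; positivity
  obtain ⟨T₀, B, hB, hT₀, hBk⟩ := exists_pow_bounds (κ := ε / (m * E ^ m)) hs0 hst (by positivity)
  obtain ⟨C, hC, hprod⟩ := hT.prod_le (B * E)
  refine ⟨C * (((m : ℝ) ^ (T₀ + 1)) ^ (m - 1)) ^ (T₀ + 1), by positivity,
    fun μ M hM1 hμP hμ hq htail => ?_⟩
  have hfac : ∀ (i : ℕ) (J : ℕ), (∫ x : ℕ, (m : ℝ) ^ ((1 - δ) * ((min x J : ℕ) : ℝ)) ∂(μ i)) ≤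
      ∫ x, s ^ min x J ∂(μ i) := by
    intro i J
    refine integral_mono (integrable_trunc (μ i) J fun k => (m : ℝ) ^ ((1 - δ) * (k : ℝ)))
      (integrable_trunc (μ i) J fun k => s ^ k) fun x => ?_
    dsimp only
    rw [Real.rpow_mul hm0.le, Real.rpow_natCast]
    exact pow_le_pow_left₀ (by positivity) hsδ _
  have hnn : ∀ i J, 0 ≤ ∫ x : ℕ, (m : ℝ) ^ ((1 - δ) * ((min x J : ℕ) : ℝ)) ∂(μ i) :=
    fun i J => integral_nonneg fun x => by positivity
  have hEt : ∀ i ≤ M, ∫ x, t ^ min x (M - i) ∂(μ i) ≤ E := fun i hi => by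
    rw [hE]
    exact integral_pow_min_le (by linarith) htm (by positivity) fun k hk => htail i k (by omega)
  have hbound : ∀ (F : ℕ → ℝ), (∀ k, F k ≤ B * t ^ k) → ∀ i ≤ M,
      ∫ x, F (min x (M - i)) ∂(μ i) ≤ B * E := by
    intro F hF i hi
    calc ∫ x, F (min x (M - i)) ∂(μ i) ≤ ∫ x, B * t ^ min x (M - i) ∂(μ i) :=
          integral_mono (integrable_trunc (μ i) _ F)
            (integrable_trunc (μ i) _ fun k => B * t ^ k) fun x => hF _
      _ = B * ∫ x, t ^ min x (M - i) ∂(μ i) := integral_const_mul _ _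
      _ ≤ B * E := by gcongr; exact hEt i hi
  -- the last `T₀ + 1` factors are estimated trivially
  obtain ⟨N, hN⟩ : ∃ N : ℕ, N = M - (T₀ + 1) := ⟨_, rfl⟩
  have hmain : ∏ i ∈ Finset.range N,
      (∫ x : ℕ, (m : ℝ) ^ ((1 - δ) * ((min x (M - i) : ℕ) : ℝ)) ∂(μ i)) ^ (m - 1) ≤
      C * Real.exp (3 * θ * N) := by
    refine le_trans (Finset.prod_le_prod (fun i _ => pow_nonneg (hnn i _) _) fun i _ =>
      pow_le_pow_left₀ (hnn i _) (hfac i _) _)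
      (hprod (fun i => moments s (M - i) (μ i)) N ?_ ?_ ?_ ?_)
    · intro i hi
      exact admissible_moments hm (by linarith) hsm.le (by omega) (hq i (by omega))
    · intro i hi
      refine hbound (fun k => s ^ k) (fun k => le_trans ?_ (hBk k)) i (by omega)
      have : (1 : ℝ) ≤ ((k : ℝ) + 1) ^ 2 := by nlinarith [Nat.cast_nonneg (α := ℝ) k]
      exact le_mul_of_one_le_left (by positivity) this
    · intro i hi
      have h1 : (moments s (M - i) (μ i)).A + (moments s (M - i) (μ i)).B =
          ∫ x, (((min x (M - i) : ℕ) : ℝ) * s ^ min x (M - i) +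
            ((min x (M - i) : ℕ) : ℝ) ^ 2 * s ^ min x (M - i)) ∂(μ i) :=
        (integral_add (integrable_trunc (μ i) _ fun k => (k : ℝ) * s ^ k)
          (integrable_trunc (μ i) _ fun k => (k : ℝ) ^ 2 * s ^ k)).symm
      rw [h1]
      refine hbound (fun k => (k : ℝ) * s ^ k + (k : ℝ) ^ 2 * s ^ k)
        (fun k => le_trans ?_ (hBk k)) i (by omega)
      rw [← add_mul]
      gcongr
      nlinarith [Nat.cast_nonneg (α := ℝ) k]
    · intro i hi
      have h1 : M - i = M - (i + 1) + 1 := by omega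
      have h2 := hEt i (by omega)
      rw [h1] at h2
      rw [h1, hμ]
      refine stepRel_moments hm (by linarith) hsm.le (t := t) (κ := ε / (m * E ^ m)) (by linarith)
        (by positivity) (fun k hk => hT₀ k (by omega)) ?_
      have h3 : 0 ≤ ∫ x, t ^ min x (M - (i + 1) + 1) ∂(μ i) := integral_nonneg fun x => by
        have : 0 < t := by linarith
        positivity
      calc m * (ε / (m * E ^ m)) * (∫ x, t ^ min x (M - (i + 1) + 1) ∂(μ i)) ^ m
          ≤ m * (ε / (m * E ^ m)) * E ^ m := by gcongr
        _ = ε := by field_simp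
  have hlast : ∏ j ∈ Finset.range (M - N),
      (∫ x : ℕ, (m : ℝ) ^ ((1 - δ) * ((min x (M - (N + j)) : ℕ) : ℝ)) ∂(μ (N + j))) ^ (m - 1) ≤
      (((m : ℝ) ^ (T₀ + 1)) ^ (m - 1)) ^ (T₀ + 1) := by
    have h1 : ∀ j ∈ Finset.range (M - N),
        (∫ x : ℕ, (m : ℝ) ^ ((1 - δ) * ((min x (M - (N + j)) : ℕ) : ℝ)) ∂(μ (N + j))) ^ (m - 1) ≤
        ((m : ℝ) ^ (T₀ + 1)) ^ (m - 1) := by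
      intro j _
      refine pow_le_pow_left₀ (hnn _ _) ((hfac _ _).trans ?_) _
      have h2 : ∫ _x : ℕ, (m : ℝ) ^ (T₀ + 1) ∂(μ (N + j)) = (m : ℝ) ^ (T₀ + 1) := by simp
      rw [← h2]
      refine integral_mono (integrable_trunc _ _ fun k => s ^ k) (integrable_const _) fun x => ?_
      refine (pow_le_pow_left₀ hs0.le hsm.le _).trans (pow_le_pow_right₀ (by linarith) ?_)
      omega
    refine (Finset.prod_le_prod (fun j _ => pow_nonneg (hnn _ _) _) h1).trans ?_
    rw [Finset.prod_const, Finset.card_range]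
    refine pow_le_pow_right₀ (one_le_pow₀ (one_le_pow₀ (by linarith))) (by omega)
  have hexp : Real.exp (3 * θ * N) ≤ (m : ℝ) ^ (2 * δ * (M : ℝ)) := by
    rw [Real.rpow_def_of_pos hm0, Real.exp_le_exp]
    have h1 : (N : ℝ) ≤ M := by exact_mod_cast (by omega : N ≤ M)
    calc 3 * θ * N ≤ (2 * δ * Real.log m) * M := by gcongr
      _ = _ := by ring
  have hMN : M = N + (M - N) := by omega
  have hsplit := Finset.prod_range_add (fun i =>
    (∫ x : ℕ, (m : ℝ) ^ ((1 - δ) * ((min x (M - i) : ℕ) : ℝ)) ∂(μ i)) ^ (m - 1)) N (M - N)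
  rw [← hMN] at hsplit
  rw [hsplit]
  calc _ ≤ (C * Real.exp (3 * θ * N)) * (((m : ℝ) ^ (T₀ + 1)) ^ (m - 1)) ^ (T₀ + 1) :=
        mul_le_mul hmain hlast (Finset.prod_nonneg fun j _ => pow_nonneg (hnn _ _) _)
          (by positivity)
    _ ≤ (C * (m : ℝ) ^ (2 * δ * (M : ℝ))) * (((m : ℝ) ^ (T₀ + 1)) ^ (m - 1)) ^ (T₀ + 1) := by
        gcongr
    _ = _ := by ring

end DerridaRetaux

theorem mainTheorem3 (m : ℕ) (hm : 2 ≤ m) (δ : ℝ) (hδ : δ ∈ Set.Ioo (0 : ℝ) (1 / (16 * (m : ℝ))))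
    (c₁ c₂ : ℝ) (hc₁ : 0 < c₁) :
    ∃ c₃ c₄ c₅ : ℝ, 0 < c₃ ∧ 0 < c₄ ∧ 0 < c₅ ∧
      ∀ ν : Measure ℕ, IsProbabilityMeasure ν → ν {0} = 0 →
        ν.real (Set.Ici 2) = c₁ →
        Integrable (fun x : ℕ => (m : ℝ) ^ ((1 - δ) * (x : ℝ))) ν →
        ∫ x : ℕ, (m : ℝ) ^ ((1 - δ) * (x : ℝ)) ∂ν = c₂ →
        ∀ p ∈ Set.Ioo (0 : ℝ) 1, ∀ n M : ℕ, 1 ≤ M → M < n →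
          (∏ i ∈ Finset.range M,
              (∫ x : ℕ, (m : ℝ) ^ ((1 - δ) * ((min x (M - i) : ℕ) : ℝ))
                ∂(DerridaRetaux.law m ν p i)) ^ (m - 1)
            ≤ c₃ * (m : ℝ) ^ (2 * δ * (M : ℝ))) ∨
          (DerridaRetaux.law m ν p n).real {0} ≤ c₅ * Real.exp (-c₄ * (m : ℝ) ^ (n - M)) := by
  have hm1 : 1 ≤ m := by omega
  have hn : ((m - 1 : ℕ) : ℝ) ≠ 0 := by exact_mod_cast (by omega : m - 1 ≠ 0)
  have hn1 : (1 : ℝ) ≤ ((m - 1 : ℕ) : ℝ) := by exact_mod_cast (by omega : 1 ≤ m - 1)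
  -- `b` turns `F ↦ 2 * F ^ m` into `F ↦ F ^ m`
  obtain ⟨b, hb⟩ : ∃ b : ℝ, b = (2 : ℝ) ^ (1 / ((m - 1 : ℕ) : ℝ)) := ⟨_, rfl⟩
  have hb1 : 1 ≤ b := by rw [hb]; exact Real.one_le_rpow (by norm_num) (by positivity)
  have hb2 : b ^ (m - 1) = 2 := by
    rw [hb, ← Real.rpow_natCast, ← Real.rpow_mul (by norm_num), one_div_mul_cancel hn,
      Real.rpow_one]
  have hb3 : b ≤ 2 := hb2 ▸ le_self_pow₀ hb1 (by omega)
  obtain ⟨e, he, he1, he2⟩ : ∃ e : ℝ, 0 < e ∧ e ≤ 1 / 20 ∧ e ≤ c₁ / 4 :=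
    ⟨min (1 / 20) (c₁ / 4), by positivity, min_le_left _ _, min_le_right _ _⟩
  obtain ⟨C, hC, hprod⟩ := DerridaRetaux.exists_prod_le hm (q₀ := min (1 / 100) (c₁ / 6))
    (by positivity) hδ.1
  refine ⟨C, e, 1, hC, he, one_pos, fun ν hν hν0 hνc _ _ p hp n M hM1 hMn => ?_⟩
  have hP := DerridaRetaux.isProbabilityMeasure_law (m := m) (ν := ν) hp
  have hstep : ∀ n, DerridaRetaux.law m ν p (n + 1) =
      DerridaRetaux.step m (DerridaRetaux.law m ν p n) := fun _ => rfl
  rw [one_mul]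
  rcases le_or_gt (b * DerridaRetaux.halfMoment (DerridaRetaux.law m ν p M)) (Real.exp (-e))
    with hM | hM
  · exact Or.inr (DerridaRetaux.measureReal_zero_le_exp hm1 hstep hb1 hb2 hMn.le hM)
  · left
    have hF : ∀ i ≤ M, 1 - e < b * DerridaRetaux.halfMoment (DerridaRetaux.law m ν p i) :=
      fun i hi => DerridaRetaux.one_sub_lt_mul_halfMoment hm1 hstep (by linarith) hb2 he.le hM hi
    refine hprod _ M hM1 hP hstep (fun i hi => ?_) (fun i k hik => ?_)
    · refine DerridaRetaux.le_measureReal_zero hm hstep hb1 hb2 he1 hF (min_le_left _ _)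
        (fun h2 => (min_le_right _ _).trans ?_) hi
      have hb' : b = 2 := by subst h2; simpa using hb2
      have h3 := hF 0 (Nat.zero_le _)
      rw [hb'] at h3
      have : IsProbabilityMeasure (DerridaRetaux.initialLaw ν p) := hP 0
      exact DerridaRetaux.le_initialLaw_zero hν0 hp hνc he2 h3
    · -- `(1 - e) / b ≥ (1 - 1 / 20) / 2 = 19 / 40`
      refine DerridaRetaux.measureReal_Ici_le hm hstep (fun j hj => ?_) hik
      have h1 := hF j hj
      have h2 := mul_le_mul_of_nonneg_right hb3
        (DerridaRetaux.halfMoment_nonneg (μ := DerridaRetaux.law m ν p j))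
      linarith
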